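/- Let $R$ be a measurable function on the unit circle $\mathbb T$ with $|R|\le 1$ a.e. and $\log(1-|R|)\in L^1$, and put $W=\begin{bmatrix}1&\overline R\\ R&1\end{bmatrix}$. Let $L^R$ be the Hilbert space of measurable $\mathbb C^2$-valued functions on $\mathbb T$ with inner product $\int_{\mathbb T}\langle W^{-1}f,g\rangle\,dm$ ($m$ the normalized Lebesgue measure), and let $U_R$ be multiplication by $t$ on $L^R$. Let $H^2_+$ be the Hardy space in $L^2$ and $H^2_-=L^2\ominus H^2_+$. For $n,m\in\mathbb Z$ let $$\check{\mathcal H}_{n,m}=\mathrm{Clos}\; W\begin{bmatrix}t^nH^2_+\\ \bar t^{\,m}H^2_-\end{bmatrix},\quad \check\Delta_{n,m}=\check{\mathcal H}_{n,m}\ominus\check{\mathcal H}_{n+1,m},\quad \widetilde{\check\Delta}_{n,m}=\check{\mathcal H}_{n,m}\ominus\check{\mathcal H}_{n,m+1},$$ $$e_n=\begin{bmatrix}1\\R\end{bmatrix}t^n,\qquad d_m=\begin{bmatrix}\overline R\\1\end{bmatrix}\bar t^{\,m+1}.$$ Given unit vectors $\check K_{n,m}\in\check\Delta_{n,m}$ and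 $\widetilde{\check K}_{n,m}\in\widetilde{\check\Delta}_{n,m}$, let $\mathcal U$ be the unitary dilation, acting on $\cdots\oplus\mathbb C\oplus\mathbb C\oplus\check{\mathcal H}_{n,m}\oplus\mathbb C\oplus\mathbb C\oplus\cdots$, of the unitary colligation $\check{\mathcal H}_{n,m}\oplus\mathbb C\to\check{\mathcal H}_{n,m}\oplus\mathbb C$, $$(h+\beta\widetilde{\check K}_{n,m},\ \alpha)\mapsto(U_Rh+\alpha\check K_{n,m},\ \beta)\qquad(h\in\check{\mathcal H}_{n,m+1},\ \alpha,\beta\in\mathbb C),$$ and let $s_{1,n,m}$, $s_{2,n,m}$ be the functions on $\mathbb T$ with Fourier series $$s_{1,n,m}\sim\sum_{k\in\mathbb Z}t^k\langle\mathcal U^{-k}\,\mathcal U^{-n}e_n,\ \check K_{n,m}\rangle,\qquad s_{2,n,m}\sim\sum_{k\in\mathbb Z}t^k\langle\mathcal U^{-k}\,\mathcal U\widetilde{\check K}_{n,m},\ \mathcal U^{m+1}d_m\rangle .$$ Then for all $n,m\in\mathbb Z$ there is exactly one choice of the unit vectors $\check K_{n,m}$, $\widetilde{\check K}_{n,m}$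 for which the harmonic extensions of $t^ns_{1,n,m}$ and of $t^ms_{2,n,m}$ to the unit disk are positive at $0$. With this normalization: (1) for every $n\in\mathbb Z$, $\check K_{n,m}\to e_n$ in $L^R$ as $m\to\infty$; (2) for every $m\in\mathbb Z$, $\widetilde{\check K}_{n,m}\to d_m$ in $L^R$ as $n\to\infty$; (3) there are functions $\check a_j$, $j\in\mathbb Z$, on the unit disk such that the harmonic extensions of $t^ns_{1,n,m}$ and of $t^ms_{2,n,m}$ are both equal to $\check a_{n+m}$ for all $n,m\in\mathbb Z$, and $\check a_j(0)\to1$ as $j\to\infty$. -/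

import Mathlib

noncomputable section

namespace CMV

open MeasureTheory

open scoped ComplexConjugate

/-- The unit circle, parametrized by `x ↦ t = fourier 1 x = exp (2 π i x)`; thus `t ^ n` is the
function `fourier n`. -/
abbrev T : Type := UnitAddCircle

/-- Normalized Lebesgue measure on the circle. -/
abbrev mT : Measure T := AddCircle.haarAddCircle

/-- Szegő contractive functions on the circle: `|R| ≤ 1` a.e. and `log (1 - |R|) ∈ L¹`. The
integrability of the (extended real valued) logarithm forces `|R| < 1` a.e.; this is spelled out
because `Real.log 0 = 0`. -/
structure SzegoFunction where
  /-- the underlying function -/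
  toFun : T → ℂ
  aestronglyMeasurable : AEStronglyMeasurable toFun mT
  norm_lt_one : ∀ᵐ x ∂mT, ‖toFun x‖ < 1
  integrable_log : Integrable (fun x => Real.log (1 - ‖toFun x‖)) mT

/-! ### The space `L^R` -/

/-- The sesquilinear form `⟨W⁻¹ v, w⟩` on `ℂ²` for `W = [[1, conj r], [r, 1]]`, where
`W⁻¹ = (1 - |r|²)⁻¹ [[1, - conj r], [-r, 1]]` (linear in `v`, conjugate linear in `w`). -/
def wForm (r : ℂ) (v w : ℂ × ℂ) : ℂ :=
  ((v.1 - conj r * v.2) * conj w.1 + (v.2 - r * v.1) * conj w.2) / ((1 - ‖r‖ ^ 2 : ℝ) : ℂ)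

theorem wForm_eq {r : ℂ} (hr : ‖r‖ < 1) (v w : ℂ × ℂ) :
    wForm r v w = v.1 * conj w.1 +
      ((v.2 - r * v.1) / (Real.sqrt (1 - ‖r‖ ^ 2) : ℂ)) *
        conj ((w.2 - r * w.1) / (Real.sqrt (1 - ‖r‖ ^ 2) : ℂ)) := by
  have h0 : (0 : ℝ) < 1 - ‖r‖ ^ 2 := by nlinarith [norm_nonneg r]
  have h1 : ((Real.sqrt (1 - ‖r‖ ^ 2) : ℝ) : ℂ) ^ 2 = ((1 - ‖r‖ ^ 2 : ℝ) : ℂ) := by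
    rw [← Complex.ofReal_pow, Real.sq_sqrt h0.le]
  have h2 : ((Real.sqrt (1 - ‖r‖ ^ 2) : ℝ) : ℂ) ≠ 0 := by
    exact_mod_cast (Real.sqrt_pos.2 h0).ne'
  have h3 : ((1 - ‖r‖ ^ 2 : ℝ) : ℂ) = 1 - r * conj r := by
    rw [Complex.mul_conj']; push_cast; ring
  have h4 : (1 - r * conj r : ℂ) ≠ 0 := by rw [← h3]; exact_mod_cast h0.ne'
  unfold wForm
  rw [map_div₀, Complex.conj_ofReal, div_mul_div_comm, ← pow_two, h1, h3]
  rw [div_eq_iff h4, add_mul, div_mul_cancel₀ _ h4]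
  simp only [map_sub, map_mul]
  ring

variable (R : SzegoFunction)

/-- The class of `R` modulo equality almost everywhere. -/
def Rae : T →ₘ[mT] ℂ := AEEqFun.mk R.toFun R.aestronglyMeasurable

theorem coeFn_Rae : (Rae R : T → ℂ) =ᵐ[mT] R.toFun := AEEqFun.coeFn_mk _ _

/-- The first component of the auxiliary isometry of `L^R` into `L² ⊕ L²`. -/
def aux1 (f : (T →ₘ[mT] ℂ) × (T →ₘ[mT] ℂ)) : T → ℂ := fun x => f.1 x

/-- The second component of the auxiliary isometry of `L^R` into `L² ⊕ L²`. -/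
def aux2 (f : (T →ₘ[mT] ℂ) × (T →ₘ[mT] ℂ)) : T → ℂ :=
  fun x => (f.2 x - R.toFun x * f.1 x) / (Real.sqrt (1 - ‖R.toFun x‖ ^ 2) : ℂ)

theorem aux1_meas (f) : AEStronglyMeasurable (aux1 f) mT := f.1.aestronglyMeasurable

theorem aux2_meas (f) : AEStronglyMeasurable (aux2 R f) mT := by
  have h : AEMeasurable R.toFun mT := R.aestronglyMeasurable.aemeasurable
  have h1 := f.1.aestronglyMeasurable.aemeasurable
  have h2 := f.2.aestronglyMeasurable.aemeasurable
  apply AEMeasurable.aestronglyMeasurable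
  unfold aux2
  have : AEMeasurable (fun x => ((Real.sqrt (1 - ‖R.toFun x‖ ^ 2) : ℝ) : ℂ)) mT := by fun_prop
  exact (h2.sub (h.mul h1)).div this

theorem wForm_ae (f g : (T →ₘ[mT] ℂ) × (T →ₘ[mT] ℂ)) :
    (fun x => wForm (R.toFun x) (f.1 x, f.2 x) (g.1 x, g.2 x)) =ᵐ[mT]
      fun x => aux1 f x * conj (aux1 g x) + aux2 R f x * conj (aux2 R g x) := by
  filter_upwards [R.norm_lt_one] with x hx
  exact wForm_eq hx _ _

theorem integrable_iff (f : (T →ₘ[mT] ℂ) × (T →ₘ[mT] ℂ)) :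
    Integrable (fun x => wForm (R.toFun x) (f.1 x, f.2 x) (f.1 x, f.2 x)) mT ↔
      MemLp (aux1 f) 2 mT ∧ MemLp (aux2 R f) 2 mT := by
  rw [integrable_congr (wForm_ae R f f), memLp_two_iff_integrable_sq_norm (aux1_meas f),
    memLp_two_iff_integrable_sq_norm (aux2_meas R f)]
  simp only [Complex.mul_conj']
  constructor
  · intro h
    have h' := h.re
    simp only [← Complex.ofReal_pow, ← Complex.ofReal_add] at h'
    constructor
    · refine h'.mono' ((aux1_meas f).norm.pow 2) (Filter.Eventually.of_forall fun x => ?_)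
      simp only [Real.norm_eq_abs, abs_pow, abs_norm, RCLike.re_to_complex, Complex.ofReal_re]
      nlinarith [sq_nonneg ‖aux2 R f x‖]
    · refine h'.mono' ((aux2_meas R f).norm.pow 2) (Filter.Eventually.of_forall fun x => ?_)
      simp only [Real.norm_eq_abs, abs_pow, abs_norm, RCLike.re_to_complex, Complex.ofReal_re]
      nlinarith [sq_nonneg ‖aux1 f x‖]
  · rintro ⟨h1, h2⟩
    exact ((h1.ofReal (𝕜 := ℂ)).add (h2.ofReal (𝕜 := ℂ))).congr
      (Filter.Eventually.of_forall fun x => by simp)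

theorem aux1_add (f g) : aux1 (f + g) =ᵐ[mT] aux1 f + aux1 g := AEEqFun.coeFn_add f.1 g.1

theorem aux1_smul (c : ℂ) (f) : aux1 (c • f) =ᵐ[mT] c • aux1 f := AEEqFun.coeFn_smul c f.1

theorem aux2_add (f g) : aux2 R (f + g) =ᵐ[mT] aux2 R f + aux2 R g := by
  filter_upwards [AEEqFun.coeFn_add f.1 g.1, AEEqFun.coeFn_add f.2 g.2] with x h1 h2
  simp only [aux2, Prod.fst_add, Prod.snd_add, Pi.add_apply, h1, h2]
  ring

theorem aux2_smul (c : ℂ) (f) : aux2 R (c • f) =ᵐ[mT] c • aux2 R f := by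
  filter_upwards [AEEqFun.coeFn_smul c f.1, AEEqFun.coeFn_smul c f.2] with x h1 h2
  simp only [aux2, Prod.smul_fst, Prod.smul_snd, Pi.smul_apply, h1, h2, smul_eq_mul]
  ring

/-- The space `L^R` of (classes of) measurable functions `f = (f₁, f₂)` with
`∫ ⟨W⁻¹ f, f⟩ < ∞`, `W = [[1, conj R], [R, 1]]`. -/
def LRsub : Submodule ℂ ((T →ₘ[mT] ℂ) × (T →ₘ[mT] ℂ)) where
  carrier := {f | Integrable (fun x => wForm (R.toFun x) (f.1 x, f.2 x) (f.1 x, f.2 x)) mT}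
  zero_mem' := by
    refine (integrable_zero T ℂ mT).congr ?_
    filter_upwards [AEEqFun.coeFn_zero (α := T) (μ := mT) (β := ℂ)] with x hx
    simp [wForm, hx]
  add_mem' := by
    intro f g hf hg
    have hf' := (integrable_iff R f).1 hf
    have hg' := (integrable_iff R g).1 hg
    exact (integrable_iff R (f + g)).2
      ⟨(hf'.1.add hg'.1).ae_eq (aux1_add f g).symm, (hf'.2.add hg'.2).ae_eq (aux2_add R f g).symm⟩
  smul_mem' := by
    intro c f hf
    have hf' := (integrable_iff R f).1 hf
    exact (integrable_iff R (c • f)).2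
      ⟨(hf'.1.const_smul c).ae_eq (aux1_smul c f).symm,
        (hf'.2.const_smul c).ae_eq (aux2_smul R c f).symm⟩

/-- The space `L^R` as a type. -/
def LR : Type := LRsub R

instance : AddCommGroup (LR R) := inferInstanceAs (AddCommGroup (LRsub R))

instance : Module ℂ (LR R) := inferInstanceAs (Module ℂ (LRsub R))

variable {R} in
/-- The underlying pair of (classes of) functions. -/
def LR.fn (f : LR R) : (T →ₘ[mT] ℂ) × (T →ₘ[mT] ℂ) := f.1

variable {R} in
theorem LR.mem (f : LR R) : MemLp (aux1 f.fn) 2 mT ∧ MemLp (aux2 R f.fn) 2 mT :=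
  (integrable_iff R f.1).1 f.2

/-- Auxiliary linear map of `L^R` to `L² ⊕ L²`. -/
def auxMap : LR R →ₗ[ℂ] WithLp 2 (Lp ℂ 2 mT × Lp ℂ 2 mT) where
  toFun f := WithLp.toLp 2 (f.mem.1.toLp, f.mem.2.toLp)
  map_add' f g := by
    have h1 : (f + g).mem.1.toLp = f.mem.1.toLp + g.mem.1.toLp := by
      rw [← MemLp.toLp_add]; exact MemLp.toLp_congr _ _ (aux1_add f.fn g.fn)
    have h2 : (f + g).mem.2.toLp = f.mem.2.toLp + g.mem.2.toLp := by
      rw [← MemLp.toLp_add]; exact MemLp.toLp_congr _ _ (aux2_add R f.fn g.fn)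
    rw [h1, h2]; rfl
  map_smul' c f := by
    have h1 : (c • f).mem.1.toLp = c • f.mem.1.toLp := by
      rw [← MemLp.toLp_const_smul]; exact MemLp.toLp_congr _ _ (aux1_smul c f.fn)
    have h2 : (c • f).mem.2.toLp = c • f.mem.2.toLp := by
      rw [← MemLp.toLp_const_smul]; exact MemLp.toLp_congr _ _ (aux2_smul R c f.fn)
    rw [h1, h2]; rfl

/-- The inner product of `L^R`. Mathlib's inner products are linear in the second argument. -/
instance : Inner ℂ (LR R) where
  inner f g := ∫ x, wForm (R.toFun x) (g.fn.1 x, g.fn.2 x) (f.fn.1 x, f.fn.2 x) ∂mT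

theorem inner_def (f g : LR R) :
    inner ℂ f g = ∫ x, wForm (R.toFun x) (g.fn.1 x, g.fn.2 x) (f.fn.1 x, f.fn.2 x) ∂mT := rfl

theorem inner_eq_aux (f g : LR R) : inner ℂ f g = inner ℂ (auxMap R f) (auxMap R g) := by
  rw [inner_def, integral_congr_ae (wForm_ae R g.fn f.fn), WithLp.prod_inner_apply,
    L2.inner_def, L2.inner_def, ← integral_add (L2.integrable_inner _ _) (L2.integrable_inner _ _)]
  refine integral_congr_ae ?_
  filter_upwards [f.mem.1.coeFn_toLp, f.mem.2.coeFn_toLp, g.mem.1.coeFn_toLp,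
    g.mem.2.coeFn_toLp] with x h1 h2 h3 h4
  simp only [auxMap, LinearMap.coe_mk, AddHom.coe_mk, RCLike.inner_apply, h1, h2, h3, h4]

theorem auxMap_injective : Function.Injective (auxMap R) := by
  intro f g h
  have h1 : f.mem.1.toLp = g.mem.1.toLp := congrArg (fun u => u.ofLp.1) h
  have h2 : f.mem.2.toLp = g.mem.2.toLp := congrArg (fun u => u.ofLp.2) h
  rw [MemLp.toLp_eq_toLp_iff] at h1 h2
  have e1 : f.fn.1 = g.fn.1 := AEEqFun.ext h1
  have e2 : f.fn.2 = g.fn.2 := by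
    refine AEEqFun.ext ?_
    filter_upwards [h1, h2, R.norm_lt_one] with x k1 k2 hx
    have h0 : (0 : ℝ) < 1 - ‖R.toFun x‖ ^ 2 := by nlinarith [norm_nonneg (R.toFun x)]
    have h3 : ((Real.sqrt (1 - ‖R.toFun x‖ ^ 2) : ℝ) : ℂ) ≠ 0 := by
      exact_mod_cast (Real.sqrt_pos.2 h0).ne'
    simp only [aux1] at k1
    simp only [aux2] at k2
    rw [div_left_inj' h3, k1] at k2
    exact sub_left_injective k2
  exact Subtype.ext (Prod.ext e1 e2)

/-- The axioms of an inner product space for `L^R`. -/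
abbrev LR.core : InnerProductSpace.Core ℂ (LR R) where
  toInner := inferInstance
  conj_inner_symm f g := by rw [inner_eq_aux, inner_eq_aux, inner_conj_symm]
  re_inner_nonneg f := by rw [inner_eq_aux]; exact inner_self_nonneg
  add_left f g h := by simp only [inner_eq_aux, map_add, inner_add_left]
  smul_left f g c := by simp only [inner_eq_aux, map_smul, inner_smul_left]
  definite f h := by
    rw [inner_eq_aux, inner_self_eq_zero] at h
    exact auxMap_injective R (h.trans (map_zero _).symm)

instance : NormedAddCommGroup (LR R) := (LR.core R).toNormedAddCommGroup

instance : InnerProductSpace ℂ (LR R) := InnerProductSpace.ofCore (LR.core R).toCore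

theorem auxMap_surjective : Function.Surjective (auxMap R) := by
  intro p
  have hs : AEStronglyMeasurable (fun x => ((Real.sqrt (1 - ‖R.toFun x‖ ^ 2) : ℝ) : ℂ)) mT := by
    have h : AEMeasurable R.toFun mT := R.aestronglyMeasurable.aemeasurable
    apply AEMeasurable.aestronglyMeasurable
    fun_prop
  let f : (T →ₘ[mT] ℂ) × (T →ₘ[mT] ℂ) :=
    (p.ofLp.1, Rae R * (p.ofLp.1 : T →ₘ[mT] ℂ) + AEEqFun.mk _ hs * (p.ofLp.2 : T →ₘ[mT] ℂ))
  have k1 : aux1 f =ᵐ[mT] p.ofLp.1 := Filter.EventuallyEq.rfl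
  have k2 : aux2 R f =ᵐ[mT] p.ofLp.2 := by
    filter_upwards [AEEqFun.coeFn_add (Rae R * (p.ofLp.1 : T →ₘ[mT] ℂ))
        (AEEqFun.mk _ hs * (p.ofLp.2 : T →ₘ[mT] ℂ)),
      AEEqFun.coeFn_mul (Rae R) (p.ofLp.1 : T →ₘ[mT] ℂ),
      AEEqFun.coeFn_mul (AEEqFun.mk _ hs) (p.ofLp.2 : T →ₘ[mT] ℂ), coeFn_Rae R,
      AEEqFun.coeFn_mk _ hs, R.norm_lt_one] with x h1 h2 h3 h4 h5 hx
    have h0 : (0 : ℝ) < 1 - ‖R.toFun x‖ ^ 2 := by nlinarith [norm_nonneg (R.toFun x)]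
    have h6 : ((Real.sqrt (1 - ‖R.toFun x‖ ^ 2) : ℝ) : ℂ) ≠ 0 := by
      exact_mod_cast (Real.sqrt_pos.2 h0).ne'
    simp only [aux2, f]
    rw [h1, Pi.add_apply, h2, h3, Pi.mul_apply, Pi.mul_apply, h4, h5, add_sub_cancel_left,
      mul_div_cancel_left₀ _ h6]
  have hf : f ∈ LRsub R := (integrable_iff R f).2
    ⟨(Lp.memLp p.ofLp.1).ae_eq k1.symm, (Lp.memLp p.ofLp.2).ae_eq k2.symm⟩
  let F : LR R := ⟨f, hf⟩
  refine ⟨F, ?_⟩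
  have e1 : F.mem.1.toLp = p.ofLp.1 := Lp.ext ((MemLp.coeFn_toLp _).trans k1)
  have e2 : F.mem.2.toLp = p.ofLp.2 := Lp.ext ((MemLp.coeFn_toLp _).trans k2)
  change WithLp.toLp 2 (F.mem.1.toLp, F.mem.2.toLp) = p
  rw [e1, e2]

/-- The auxiliary unitary map of `L^R` onto `L² ⊕ L²`. -/
def auxEquiv : LR R ≃ₗᵢ[ℂ] WithLp 2 (Lp ℂ 2 mT × Lp ℂ 2 mT) :=
  (LinearEquiv.ofBijective (auxMap R)
    ⟨auxMap_injective R, auxMap_surjective R⟩).isometryOfInner fun f g => (inner_eq_aux R f g).symm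

instance : CompleteSpace (LR R) :=
  (completeSpace_congr (e := (auxEquiv R).toEquiv)
    (auxEquiv R).isometry.isUniformEmbedding).2 inferInstance

theorem ae_mul_add (a b c : T →ₘ[mT] ℂ) : a * (b + c) = a * b + a * c := by
  refine AEEqFun.ext ?_
  filter_upwards [AEEqFun.coeFn_mul a (b + c), AEEqFun.coeFn_add b c,
    AEEqFun.coeFn_add (a * b) (a * c), AEEqFun.coeFn_mul a b, AEEqFun.coeFn_mul a c]
    with x h1 h2 h3 h4 h5
  rw [h1, h3, Pi.mul_apply, h2, Pi.add_apply, Pi.add_apply, h4, h5, Pi.mul_apply, Pi.mul_apply,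
    mul_add]

theorem ae_mul_smul (z : ℂ) (a b : T →ₘ[mT] ℂ) : a * (z • b) = z • (a * b) := by
  refine AEEqFun.ext ?_
  filter_upwards [AEEqFun.coeFn_mul a (z • b), AEEqFun.coeFn_smul z b,
    AEEqFun.coeFn_smul z (a * b), AEEqFun.coeFn_mul a b] with x h1 h2 h3 h4
  rw [h1, h3, Pi.mul_apply, h2, Pi.smul_apply, Pi.smul_apply, h4, Pi.mul_apply, mul_smul_comm]

/-! ### Multiplication by the independent variable -/

/-- The function `t` (as a class modulo equality a.e.). -/
def tae : T →ₘ[mT] ℂ := AEEqFun.mk (fourier 1) (fourier 1).continuous.aestronglyMeasurable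

theorem coeFn_tae : (tae : T → ℂ) =ᵐ[mT] fourier 1 := AEEqFun.coeFn_mk _ _

theorem wForm_mul (r c : ℂ) (hc : ‖c‖ = 1) (v w : ℂ × ℂ) :
    wForm r (c * v.1, c * v.2) (c * w.1, c * w.2) = wForm r v w := by
  have h : c * conj c = 1 := by rw [Complex.mul_conj', hc]; norm_num
  simp only [wForm, map_mul]
  congr 1
  linear_combination ((v.1 - conj r * v.2) * conj w.1 + (v.2 - r * v.1) * conj w.2) * h

theorem norm_fourier_apply (k : ℤ) (x : T) : ‖fourier k x‖ = 1 := by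
  rw [fourier_apply]; exact Circle.norm_coe _

theorem wForm_tae (f g : (T →ₘ[mT] ℂ) × (T →ₘ[mT] ℂ)) :
    (fun x => wForm (R.toFun x) ((tae * f.1) x, (tae * f.2) x) ((tae * g.1) x, (tae * g.2) x))
      =ᵐ[mT] fun x => wForm (R.toFun x) (f.1 x, f.2 x) (g.1 x, g.2 x) := by
  filter_upwards [AEEqFun.coeFn_mul tae f.1, AEEqFun.coeFn_mul tae f.2,
    AEEqFun.coeFn_mul tae g.1, AEEqFun.coeFn_mul tae g.2, coeFn_tae] with x h1 h2 h3 h4 h5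
  rw [h1, h2, h3, h4]
  simp only [Pi.mul_apply, h5]
  exact wForm_mul _ _ (norm_fourier_apply 1 x) (f.1 x, f.2 x) (g.1 x, g.2 x)

/-- The operator `U_R` of multiplication by the independent variable `t` on `L^R`, as a linear
isometry. -/
def UR : LR R →ₗᵢ[ℂ] LR R :=
  LinearMap.isometryOfInner
    { toFun := fun f => ⟨(tae * f.fn.1, tae * f.fn.2),
        (integrable_congr (wForm_tae R f.fn f.fn)).2 f.2⟩
      map_add' := fun _ _ => Subtype.ext (Prod.ext (ae_mul_add _ _ _) (ae_mul_add _ _ _))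
      map_smul' := fun _ _ =>
        Subtype.ext (Prod.ext (ae_mul_smul _ _ _) (ae_mul_smul _ _ _)) }
    fun f g => integral_congr_ae (wForm_tae R g.fn f.fn)

/-! ### The subspaces `H_{n,m}` -/

theorem Rmul_memLp {u : T → ℂ} (hu : MemLp u 2 mT) : MemLp (fun x => R.toFun x * u x) 2 mT := by
  refine hu.mono (R.aestronglyMeasurable.mul hu.1) ?_
  filter_upwards [R.norm_lt_one] with x hx
  rw [norm_mul]
  exact mul_le_of_le_one_left (norm_nonneg _) hx.le

/-- The pair `(g₁ + conj R g₂, R g₁ + g₂)`. -/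
def weightPair (g : Lp ℂ 2 mT × Lp ℂ 2 mT) : (T →ₘ[mT] ℂ) × (T →ₘ[mT] ℂ) :=
  ((g.1 : T →ₘ[mT] ℂ) + star (Rae R) * (g.2 : T →ₘ[mT] ℂ),
    Rae R * (g.1 : T →ₘ[mT] ℂ) + (g.2 : T →ₘ[mT] ℂ))

theorem weightPair_ae (g : Lp ℂ 2 mT × Lp ℂ 2 mT) :
    ∀ᵐ x ∂mT, (weightPair R g).1 x = g.1 x + conj (R.toFun x) * g.2 x ∧
      (weightPair R g).2 x = R.toFun x * g.1 x + g.2 x := by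
  filter_upwards [AEEqFun.coeFn_add (g.1 : T →ₘ[mT] ℂ) (star (Rae R) * (g.2 : T →ₘ[mT] ℂ)),
    AEEqFun.coeFn_mul (star (Rae R)) (g.2 : T →ₘ[mT] ℂ),
    AEEqFun.coeFn_add (Rae R * (g.1 : T →ₘ[mT] ℂ)) (g.2 : T →ₘ[mT] ℂ),
    AEEqFun.coeFn_mul (Rae R) (g.1 : T →ₘ[mT] ℂ), coeFn_Rae R,
    AEEqFun.coeFn_star (Rae R)] with x h1 h2 h3 h4 h5 h6
  constructor
  · rw [weightPair, h1, Pi.add_apply, h2, Pi.mul_apply, h6, Pi.star_apply, h5]; rfl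
  · rw [weightPair, h3, Pi.add_apply, h4, Pi.mul_apply, h5]

theorem weightPair_mem (g : Lp ℂ 2 mT × Lp ℂ 2 mT) : weightPair R g ∈ LRsub R := by
  have hR := Rmul_memLp R (Lp.memLp g.1)
  have hR' : MemLp (fun x => conj (R.toFun x) * g.2 x) 2 mT := by
    refine (Rmul_memLp R (Lp.memLp g.2)).mono ?_ (Filter.Eventually.of_forall fun x => ?_)
    · exact (Complex.continuous_conj.comp_aestronglyMeasurable R.aestronglyMeasurable).mul
        (Lp.memLp g.2).1
    · simp
  have i : Integrable (fun x => g.1 x * conj (g.1 x + conj (R.toFun x) * g.2 x) +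
      g.2 x * conj (R.toFun x * g.1 x + g.2 x)) mT :=
    ((Lp.memLp g.1).integrable_mul ((Lp.memLp g.1).add hR').star).add
      ((Lp.memLp g.2).integrable_mul (hR.add (Lp.memLp g.2)).star)
  refine i.congr ?_
  filter_upwards [weightPair_ae R g, R.norm_lt_one] with x hx hr
  rw [hx.1, hx.2]
  have h0 : (0 : ℝ) < 1 - ‖R.toFun x‖ ^ 2 := by nlinarith [norm_nonneg (R.toFun x)]
  have h3 : ((1 - ‖R.toFun x‖ ^ 2 : ℝ) : ℂ) = 1 - R.toFun x * conj (R.toFun x) := by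
    rw [Complex.mul_conj']; push_cast; ring
  have h4 : (1 - R.toFun x * conj (R.toFun x) : ℂ) ≠ 0 := by rw [← h3]; exact_mod_cast h0.ne'
  simp only [wForm]
  rw [h3, eq_div_iff h4]
  simp only [map_add, map_mul, Complex.conj_conj]
  ring

/-- The map `g ↦ W g` of `L² ⊕ L²` to `L^R`, where `W = [[1, conj R], [R, 1]]`. -/
def weightMap : (Lp ℂ 2 mT × Lp ℂ 2 mT) →ₗ[ℂ] LR R where
  toFun g := ⟨weightPair R g, weightPair_mem R g⟩
  map_add' g h := by
    refine Subtype.ext (Prod.ext ?_ ?_)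
    · change ((g.1 + h.1 : Lp ℂ 2 mT) : T →ₘ[mT] ℂ) +
        star (Rae R) * ((g.2 + h.2 : Lp ℂ 2 mT) : T →ₘ[mT] ℂ) = (_ + _) + (_ + _)
      rw [AddSubgroup.coe_add, AddSubgroup.coe_add, ae_mul_add]
      abel
    · change Rae R * ((g.1 + h.1 : Lp ℂ 2 mT) : T →ₘ[mT] ℂ) +
        ((g.2 + h.2 : Lp ℂ 2 mT) : T →ₘ[mT] ℂ) = (_ + _) + (_ + _)
      rw [AddSubgroup.coe_add, AddSubgroup.coe_add, ae_mul_add]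
      abel
  map_smul' c g := by
    refine Subtype.ext (Prod.ext ?_ ?_)
    · change c • (g.1 : T →ₘ[mT] ℂ) + star (Rae R) * (c • (g.2 : T →ₘ[mT] ℂ)) = c • (_ + _)
      rw [smul_add, ae_mul_smul]
    · change Rae R * (c • (g.1 : T →ₘ[mT] ℂ)) + c • (g.2 : T →ₘ[mT] ℂ) = c • (_ + _)
      rw [smul_add, ae_mul_smul]

theorem fourierCoeff_Lp_add (g h : Lp ℂ 2 mT) (k : ℤ) :
    fourierCoeff (g + h : Lp ℂ 2 mT) k = fourierCoeff g k + fourierCoeff h k := by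
  simp only [← fourierBasis_repr, map_add, lp.coeFn_add, Pi.add_apply]

theorem fourierCoeff_Lp_smul (c : ℂ) (g : Lp ℂ 2 mT) (k : ℤ) :
    fourierCoeff (c • g : Lp ℂ 2 mT) k = c * fourierCoeff g k := by
  simp only [← fourierBasis_repr, map_smul, lp.coeFn_smul, Pi.smul_apply, smul_eq_mul]

theorem fourierCoeff_Lp_zero (k : ℤ) : fourierCoeff (0 : Lp ℂ 2 mT) k = 0 := by
  simp only [← fourierBasis_repr, map_zero, lp.coeFn_zero, Pi.zero_apply]

/-- `t ^ n H²₊`: the functions in `L²` whose Fourier coefficients with index `< n` vanish. -/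
def hardyPlus (n : ℤ) : Submodule ℂ (Lp ℂ 2 mT) where
  carrier := {g | ∀ k : ℤ, k < n → fourierCoeff g k = 0}
  zero_mem' k _ := fourierCoeff_Lp_zero k
  add_mem' hg hh k hk := by rw [fourierCoeff_Lp_add, hg k hk, hh k hk, add_zero]
  smul_mem' c g hg k hk := by rw [fourierCoeff_Lp_smul, hg k hk, mul_zero]

/-- `(conj t) ^ m H²₋`, where `H²₋ = L² ⊖ H²₊`: the functions in `L²` whose Fourier coefficients
with index `≥ -m` vanish. -/
def hardyMinus (m : ℤ) : Submodule ℂ (Lp ℂ 2 mT) where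
  carrier := {g | ∀ k : ℤ, -m ≤ k → fourierCoeff g k = 0}
  zero_mem' k _ := fourierCoeff_Lp_zero k
  add_mem' hg hh k hk := by rw [fourierCoeff_Lp_add, hg k hk, hh k hk, add_zero]
  smul_mem' c g hg k hk := by rw [fourierCoeff_Lp_smul, hg k hk, mul_zero]

/-- `H_{n,m}`, the closure in `L^R` of `W (t ^ n H²₊ ⊕ (conj t) ^ m H²₋)`. -/
def checkH (n m : ℤ) : Submodule ℂ (LR R) :=
  (((hardyPlus n).prod (hardyMinus m)).map (weightMap R)).topologicalClosure

instance (n m : ℤ) : CompleteSpace (checkH R n m) :=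
  inferInstanceAs (CompleteSpace (Submodule.topologicalClosure _))

theorem checkH_le {n n' m m' : ℤ} (hn : n' ≤ n) (hm : m' ≤ m) :
    checkH R n m ≤ checkH R n' m' :=
  Submodule.topologicalClosure_mono (Submodule.map_mono (Submodule.prod_mono
    (fun _ hg k hk => hg k (by omega)) (fun _ hg k hk => hg k (by omega))))

/-- `Δ_{n,m} = H_{n,m} ⊖ H_{n+1,m}`. -/
def checkDelta (n m : ℤ) : Submodule ℂ (LR R) := checkH R n m ⊓ (checkH R (n + 1) m)ᗮ

/-- `Δ~_{n,m} = H_{n,m} ⊖ H_{n,m+1}`. -/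
def checkDeltaT (n m : ℤ) : Submodule ℂ (LR R) := checkH R n m ⊓ (checkH R n (m + 1))ᗮ

/-- `e_n = [1; R] t ^ n`. -/
def e (n : ℤ) : LR R := weightMap R (fourierLp 2 n, 0)

/-- `d_m = [conj R; 1] (conj t) ^ (m + 1)`. -/
def d (m : ℤ) : LR R := weightMap R (0, fourierLp 2 (-(m + 1)))

theorem fourierCoeff_fourierLp (j k : ℤ) :
    fourierCoeff (fourierLp (T := 1) 2 j) k = if k = j then 1 else 0 := by
  rw [← fourierBasis_repr, ← coe_fourierBasis, HilbertBasis.repr_self, lp.single_apply,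
    Pi.single_apply]

theorem e_mem (n m : ℤ) : e R n ∈ checkH R n m :=
  Submodule.le_topologicalClosure _ (Submodule.mem_map_of_mem ⟨fun k hk => by
    rw [fourierCoeff_fourierLp, if_neg (by omega)], Submodule.zero_mem _⟩)

theorem d_mem (n m : ℤ) : d R m ∈ checkH R n m :=
  Submodule.le_topologicalClosure _ (Submodule.mem_map_of_mem ⟨Submodule.zero_mem _, fun k hk => by
    rw [fourierCoeff_fourierLp, if_neg (by omega)]⟩)

theorem tmul_memLp (g : Lp ℂ 2 mT) : MemLp (fun x => fourier 1 x * g x) 2 mT :=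
  (Lp.memLp g).mono ((fourier 1).continuous.aestronglyMeasurable.mul (Lp.memLp g).1)
    (Filter.Eventually.of_forall fun x => by rw [norm_mul, norm_fourier_apply, one_mul])

theorem fourierCoeff_tmul (g : Lp ℂ 2 mT) (k : ℤ) :
    fourierCoeff (tmul_memLp g).toLp k = fourierCoeff g (k - 1) := by
  rw [fourierCoeff_congr_ae (tmul_memLp g).coeFn_toLp]
  unfold fourierCoeff
  congr 1
  ext x
  rw [show -(k - 1) = -k + 1 by ring, fourier_add]
  simp only [smul_eq_mul]
  ring

theorem UR_weightMap (g : Lp ℂ 2 mT × Lp ℂ 2 mT) :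
    UR R (weightMap R g) = weightMap R ((tmul_memLp g.1).toLp, (tmul_memLp g.2).toLp) := by
  have h (u : Lp ℂ 2 mT) : ((tmul_memLp u).toLp : T →ₘ[mT] ℂ) = tae * (u : T →ₘ[mT] ℂ) := by
    refine AEEqFun.ext ?_
    filter_upwards [(tmul_memLp u).coeFn_toLp, AEEqFun.coeFn_mul tae (u : T →ₘ[mT] ℂ),
      coeFn_tae] with x h1 h2 h3
    rw [h1, h2, Pi.mul_apply, h3]
  refine Subtype.ext (Prod.ext ?_ ?_)
  · change tae * ((g.1 : T →ₘ[mT] ℂ) + star (Rae R) * (g.2 : T →ₘ[mT] ℂ)) = _ + _ * _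
    rw [h, h, ae_mul_add, mul_left_comm]
  · change tae * (Rae R * (g.1 : T →ₘ[mT] ℂ) + (g.2 : T →ₘ[mT] ℂ)) = _ * _ + _
    rw [h, h, ae_mul_add, mul_left_comm]

theorem UR_mem {n m : ℤ} {f : LR R} (hf : f ∈ checkH R n (m + 1)) :
    UR R f ∈ checkH R (n + 1) m := by
  have key : (((hardyPlus n).prod (hardyMinus (m + 1))).map (weightMap R)) ≤
      (((hardyPlus (n + 1)).prod (hardyMinus m)).map (weightMap R)).comap (UR R).toLinearMap := by
    rintro _ ⟨g, hg, rfl⟩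
    refine ⟨((tmul_memLp g.1).toLp, (tmul_memLp g.2).toLp), ⟨fun k hk => ?_, fun k hk => ?_⟩, ?_⟩
    · rw [fourierCoeff_tmul]; exact hg.1 _ (by omega)
    · rw [fourierCoeff_tmul]; exact hg.2 _ (by omega)
    · exact (UR_weightMap R g).symm
  exact map_mem_closure (UR R).continuous hf fun x hx => key hx

/-! ### The unitary colligation and its dilation -/

/-- `A₀ : H_{n,m} → H_{n,m}`, `h ↦ U_R (P h)`, `P` being the orthogonal projection onto
`H_{n,m+1}`. -/
def A0 (n m : ℤ) : checkH R n m →L[ℂ] checkH R n m :=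
  (((UR R).toContinuousLinearMap ∘L (checkH R n (m + 1)).starProjection) ∘L
    (checkH R n m).subtypeL).codRestrict (checkH R n m) fun h =>
      checkH_le R (by omega) le_rfl
        (UR_mem R (Submodule.starProjection_apply_mem (checkH R n (m + 1)) (h : LR R)))

/-- `ℓ²(ℕ)`, i.e. the sum of countably many copies of `Δ = ℂ` (or of `Δ~ = ℂ`). -/
abbrev ell2 : Type := lp (fun _ : ℕ => ℂ) 2

theorem memℓp_shiftLeft (x : ell2) : Memℓp (fun j : ℕ => x (j + 1)) 2 :=
  memℓp_gen (((lp.memℓp x).summable (by norm_num)).comp_injective (add_left_injective 1))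

/-- `(x₀, x₁, x₂, …) ↦ (x₁, x₂, …)`. -/
def shiftLeft : ell2 →L[ℂ] ell2 :=
  LinearMap.mkContinuous
    { toFun := fun x => ⟨fun j => x (j + 1), memℓp_shiftLeft x⟩
      map_add' := fun _ _ => rfl
      map_smul' := fun _ _ => rfl } 1 fun x => by
    rw [one_mul]
    refine lp.norm_le_of_tsum_le (by norm_num) (norm_nonneg _) ?_
    rw [lp.norm_rpow_eq_tsum (by norm_num) x]
    exact tsum_comp_le_tsum_of_inj ((lp.memℓp x).summable (by norm_num))
      (fun _ => by positivity) (add_left_injective 1)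

/-- The function `(0, x₀, x₁, …)`. -/
def consZero (x : ℕ → ℂ) : ℕ → ℂ
  | 0 => 0
  | j + 1 => x j

theorem hasSum_consZero (x : ell2) :
    HasSum (fun j => ‖consZero x j‖ ^ (2 : ENNReal).toReal) (‖x‖ ^ (2 : ENNReal).toReal) := by
  have h := lp.hasSum_norm (p := 2) (by norm_num) x
  rw [← hasSum_nat_add_iff' 1]
  simpa [consZero] using h

/-- `(x₀, x₁, x₂, …) ↦ (0, x₀, x₁, …)`. -/
def shiftRight : ell2 →L[ℂ] ell2 :=
  LinearMap.mkContinuous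
    { toFun := fun x => ⟨consZero x, memℓp_gen (hasSum_consZero x).summable⟩
      map_add' := fun x y => Subtype.ext (funext fun j => by
        cases j with
        | zero => exact (add_zero (0 : ℂ)).symm
        | succ j => rfl)
      map_smul' := fun c x => Subtype.ext (funext fun j => by
        cases j with
        | zero => exact (mul_zero c).symm
        | succ j => rfl) } 1 fun x => by
    rw [one_mul]
    exact lp.norm_le_of_tsum_le (by norm_num) (norm_nonneg _) (hasSum_consZero x).tsum_eq.le

/-- The dilation space `… ⊕ Δ ⊕ Δ ⊕ H_{n,m} ⊕ Δ~ ⊕ Δ~ ⊕ …`. In each of the two sequences the term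
with index `0` is the one adjacent to `H_{n,m}`. -/
abbrev Dil (n m : ℤ) : Type := WithLp 2 (ell2 × WithLp 2 (checkH R n m × ell2))

section

variable {R} {n m : ℤ}

/-- The vector of `H_{n,m}` given by a vector of `Δ_{n,m}`. -/
def inH (K : checkDelta R n m) : checkH R n m := ⟨K, K.2.1⟩

/-- The vector of `H_{n,m}` given by a vector of `Δ~_{n,m}`. -/
def inHT (Kt : checkDeltaT R n m) : checkH R n m := ⟨Kt, Kt.2.1⟩

/-- The embedding of `H_{n,m}` into the dilation space. -/
def emb (h : checkH R n m) : Dil R n m := WithLp.toLp 2 (0, WithLp.toLp 2 (h, 0))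

/-- The dilation of the colligation `U₀ = [[A₀, B₀], [C₀, 0]] : H_{n,m} ⊕ Δ → H_{n,m} ⊕ Δ~`,
`B₀ α = α K`, `C₀ h = ⟨h, K~⟩`, so that
`U₀ : (h' + β K~, α) ↦ (U_R h' + α K, β)` for `h' ∈ H_{n,m+1}`.
The dilation maps `(…, x₁, x₀; h; y₀, y₁, …)` to
`(…, x₂, x₁; A₀ h + B₀ x₀; C₀ h, y₀, y₁, …)`. -/
def dilU (K : checkDelta R n m) (Kt : checkDeltaT R n m) : Dil R n m →L[ℂ] Dil R n m :=
  let x : Dil R n m →L[ℂ] ell2 := WithLp.fstL 2 ℂ _ _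
  let h : Dil R n m →L[ℂ] checkH R n m := WithLp.fstL 2 ℂ _ _ ∘L WithLp.sndL 2 ℂ _ _
  let y : Dil R n m →L[ℂ] ell2 := WithLp.sndL 2 ℂ _ _ ∘L WithLp.sndL 2 ℂ _ _
  let x0 : Dil R n m →L[ℂ] ℂ := lp.evalCLM ℂ (fun _ : ℕ => ℂ) 2 0 ∘L x
  let C0h : Dil R n m →L[ℂ] ℂ := innerSL ℂ (inHT Kt) ∘L h
  (WithLp.prodContinuousLinearEquiv 2 ℂ _ _).symm.toContinuousLinearMap ∘L
    ((shiftLeft ∘L x).prod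
      ((WithLp.prodContinuousLinearEquiv 2 ℂ _ _).symm.toContinuousLinearMap ∘L
        ((A0 R n m ∘L h + x0.smulRight (inH K)).prod
          (C0h.smulRight (lp.single 2 0 (1 : ℂ)) + shiftRight ∘L y))))

/-- Integer powers of a unitary operator, with `A⁻¹ = A*`. -/
def upow {E : Type*} [NormedAddCommGroup E] [InnerProductSpace ℂ E] [CompleteSpace E]
    (A : E →L[ℂ] E) : ℤ → (E →L[ℂ] E)
  | Int.ofNat k => A ^ k
  | Int.negSucc k => (ContinuousLinearMap.adjoint A) ^ (k + 1)

/-! ### The scattering functions and the normalization -/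

/-- The scale `Ψ : Δ → K Δ`, at `1`. -/
def psi (K : checkDelta R n m) : Dil R n m := emb (inH K)

/-- The scale `Ψ~ : Δ~ → U (K~ Δ~)`, at `1`. -/
def psiT (K : checkDelta R n m) (Kt : checkDeltaT R n m) : Dil R n m :=
  dilU K Kt (emb (inHT Kt))

/-- The scale `Ψ' : ℂ → U ^ (-n) ([1; R] t ^ n) ℂ`, at `1`. -/
def psi' (K : checkDelta R n m) (Kt : checkDeltaT R n m) : Dil R n m :=
  upow (dilU K Kt) (-n) (emb ⟨e R n, e_mem R n m⟩)

/-- The scale `Ψ'' : ℂ → U ^ (m + 1) ([conj R; 1] (conj t) ^ (m + 1)) ℂ`, at `1`. -/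
def psi'' (K : checkDelta R n m) (Kt : checkDeltaT R n m) : Dil R n m :=
  upow (dilU K Kt) (m + 1) (emb ⟨d R m, d_mem R n m⟩)

/-- The `k`-th Fourier coefficient of the entry `s₁ = Ψ* (∑ t ^ k U ^ (-k)) Ψ'` of the density of
the characteristic measure of the dilation `U`. -/
def s1coeff (K : checkDelta R n m) (Kt : checkDeltaT R n m) (k : ℤ) : ℂ :=
  inner ℂ (psi K) (upow (dilU K Kt) (-k) (psi' K Kt))

/-- The `k`-th Fourier coefficient of the entry `s₂ = Ψ''* (∑ t ^ k U ^ (-k)) Ψ~` of the density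
of the characteristic measure of the dilation `U`. -/
def s2coeff (K : checkDelta R n m) (Kt : checkDeltaT R n m) (k : ℤ) : ℂ :=
  inner ℂ (psi'' K Kt) (upow (dilU K Kt) (-k) (psiT K Kt))

/-- The harmonic extension to the unit disk of the function (or distribution) on the circle with
Fourier coefficients `c k`. -/
def harmonicExt (c : ℤ → ℂ) (z : ℂ) : ℂ :=
  ∑' k : ℤ, c k * (if 0 ≤ k then z ^ k.natAbs else conj z ^ k.natAbs)

/-- The harmonic extension of `t ^ n s₁`. -/
def checkA (K : checkDelta R n m) (Kt : checkDeltaT R n m) : ℂ → ℂ :=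
  harmonicExt fun k => s1coeff K Kt (k - n)

/-- The harmonic extension of `t ^ m s₂`. -/
def checkA' (K : checkDelta R n m) (Kt : checkDeltaT R n m) : ℂ → ℂ :=
  harmonicExt fun k => s2coeff K Kt (k - m)

/-- `K` and `K~` are unit vectors of `Δ_{n,m}` and `Δ~_{n,m}`, normalized so that `t ^ n s₁` and
`t ^ m s₂` are positive at the origin. -/
structure IsNormalized (K : checkDelta R n m) (Kt : checkDeltaT R n m) : Prop where
  norm_K : ‖(K : LR R)‖ = 1
  norm_Kt : ‖(Kt : LR R)‖ = 1
  pos_K : ∃ r : ℝ, 0 < r ∧ checkA K Kt 0 = r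
  pos_Kt : ∃ r : ℝ, 0 < r ∧ checkA' K Kt 0 = r

end

end CMV

end

noncomputable section

namespace CMV

open MeasureTheory Filter

open scoped ComplexConjugate

section

variable {R : SzegoFunction}

/-! Write `P` for the orthogonal projection onto `H_{n,m+1}` and `A = U_R P` for the compression.
Two mechanisms carry the theorem: a symmetry, which gives the dependence on `n + m` alone, and the
theorem of Szegő, which gives existence and the limits.

Reduction. A vector of `H_{n,m}` has no incoming component, so on such vectors the nonnegative
powers of the dilation act as powers of `A`, up to outgoing terms that are invisible in `H_{n,m}`.
Since the dilation is unitary, the powers in the definition of `s₁` and `s₂` combine: the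
coefficients of `t ^ n s₁` and `t ^ m s₂` vanish at negative indices, and at `k ≥ 0` they are
pairings of `A ^ k K` with `e_n` and of `A ^ k d_m` with `K~`. At the origin only `k = 0` is left,
so the normalization says `⟨e_n, K⟩ > 0` and `⟨K~, d_m⟩ > 0`. Because `H_{n,m}` is the closure of `ℂ
e_n + H_{n+1,m}`, the space `Δ_{n,m}` is at most a line and `⟨·, e_n⟩` is injective on it. Hence `K`
exists and is unique as soon as `e_n ∉ H_{n+1,m}`; similarly for `K~`.

Symmetry. The conjugate linear involution `J f = t ^ s (conj f₂, conj f₁)` preserves the norm of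
`L^R`, inverts `U_R`, maps `H_{n,m}` onto `H_{m+1+s,n-1-s}` and `e_n` to `d_{n-1-s}`. It therefore
exchanges `Δ` and `Δ~` along an antidiagonal, turns compressions into adjoints of compressions
(`inner_compression_reflect`), and carries normalized vectors to normalized vectors. As `s` is
arbitrary, `t ^ n s₁` at `(n, m)` equals `t ^ m' s₂` at every `(n', m')` with the same sum.

Szegő. Let `ρ = (1 - |R|²) ^ (1/2)`. The map `f ↦ (f₂ - R f₁) / ρ` sends `W g` to `ρ g₂`, and `log ρ
∈ L¹`. Jensen's inequality keeps `ρ t ^ (-m)` away from the span of `ρ t ^ k`, `k < -m`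
(`rhoMul_fourierLp_notMem`); this shows `d_m ∉ H_{n,m+1}` and, by reflection, `e_n ∉ H_{n+1,m}`. The
normalized residual `θ` is unimodular, and division by it brings these weighted spans into shifts of
`H²₋`, a substitute for an outer factorization of `ρ`. It follows that `e_n` is orthogonal to the
intersection over `m` of `H_{n+1,m}`, hence its projections to these spaces tend to `0` and `⟨e_n,
K⟩ → 1`. For unit vectors this is norm convergence; the limit of `K~` follows from the symmetry. -/

/-! ### The reflections `f ↦ t ^ s (conj f₂, conj f₁)` of `L^R` -/

/-- The function `t ^ s` (as a class modulo equality a.e.). -/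
def fourierAE (s : ℤ) : T →ₘ[mT] ℂ :=
  AEEqFun.mk (fourier s) (fourier s).continuous.aestronglyMeasurable

theorem coeFn_fourierAE (s : ℤ) : (fourierAE s : T → ℂ) =ᵐ[mT] fourier s :=
  AEEqFun.coeFn_mk _ _

theorem LR.ext_ae {f g : LR R} (h1 : f.fn.1 =ᵐ[mT] g.fn.1) (h2 : f.fn.2 =ᵐ[mT] g.fn.2) :
    f = g :=
  Subtype.ext (Prod.ext (AEEqFun.ext h1) (AEEqFun.ext h2))

/-- The pair `(t ^ s conj f₂, t ^ s conj f₁)`. -/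
def reflectPair (s : ℤ) (f : (T →ₘ[mT] ℂ) × (T →ₘ[mT] ℂ)) :
    (T →ₘ[mT] ℂ) × (T →ₘ[mT] ℂ) :=
  (fourierAE s * star f.2, fourierAE s * star f.1)

theorem coeFn_fourierAE_mul_star (s : ℤ) (u : T →ₘ[mT] ℂ) :
    ∀ᵐ x ∂mT, (fourierAE s * star u) x = fourier s x * conj (u x) := by
  filter_upwards [AEEqFun.coeFn_mul (fourierAE s) (star u), AEEqFun.coeFn_star u,
    coeFn_fourierAE s] with x h1 h2 h3
  rw [h1, Pi.mul_apply, h2, h3, Pi.star_apply]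
  rfl

theorem wForm_reflectPair (s : ℤ) (f g : (T →ₘ[mT] ℂ) × (T →ₘ[mT] ℂ)) :
    (fun x => wForm (R.toFun x) ((reflectPair s f).1 x, (reflectPair s f).2 x)
      ((reflectPair s g).1 x, (reflectPair s g).2 x)) =ᵐ[mT]
      fun x => wForm (R.toFun x) (g.1 x, g.2 x) (f.1 x, f.2 x) := by
  filter_upwards [coeFn_fourierAE_mul_star s f.1, coeFn_fourierAE_mul_star s f.2,
    coeFn_fourierAE_mul_star s g.1, coeFn_fourierAE_mul_star s g.2] with x h1 h2 h3 h4
  simp only [reflectPair, h1, h2, h3, h4]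
  rw [wForm_mul _ _ (norm_fourier_apply s x) (conj (f.2 x), conj (f.1 x))
    (conj (g.2 x), conj (g.1 x))]
  simp only [wForm, Complex.conj_conj]
  congr 1
  ring

variable (R) in
/-- The reflection `f ↦ t ^ s (conj f₂, conj f₁)` as a conjugate linear isometry of `L^R`. -/
def reflect (s : ℤ) : LR R →ₗᵢ⋆[ℂ] LR R where
  toFun f := ⟨reflectPair s f.fn, (integrable_congr (wForm_reflectPair s f.fn f.fn)).2 f.2⟩
  map_add' f g := by
    have h (u v : T →ₘ[mT] ℂ) :
        fourierAE s * star (u + v) = fourierAE s * star u + fourierAE s * star v := by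
      refine AEEqFun.ext ?_
      filter_upwards [coeFn_fourierAE_mul_star s (u + v), AEEqFun.coeFn_add u v,
        AEEqFun.coeFn_add (fourierAE s * star u) (fourierAE s * star v),
        coeFn_fourierAE_mul_star s u, coeFn_fourierAE_mul_star s v] with x h1 h2 h3 h4 h5
      rw [h1, h2, h3, Pi.add_apply, Pi.add_apply, h4, h5, map_add, mul_add]
    exact Subtype.ext (Prod.ext (h f.fn.2 g.fn.2) (h f.fn.1 g.fn.1))
  map_smul' c f := by
    have h (u : T →ₘ[mT] ℂ) : fourierAE s * star (c • u) = conj c • (fourierAE s * star u) := by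
      refine AEEqFun.ext ?_
      filter_upwards [coeFn_fourierAE_mul_star s (c • u), AEEqFun.coeFn_smul c u,
        AEEqFun.coeFn_smul (conj c) (fourierAE s * star u), coeFn_fourierAE_mul_star s u]
        with x h1 h2 h3 h4
      rw [h1, h2, h3, Pi.smul_apply, Pi.smul_apply, h4, smul_eq_mul, smul_eq_mul, map_mul]
      ring
    exact Subtype.ext (Prod.ext (h f.fn.2) (h f.fn.1))
  norm_map' f := by
    rw [@norm_eq_sqrt_re_inner ℂ, @norm_eq_sqrt_re_inner ℂ _ _ _ _ f]
    congr 2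
    exact integral_congr_ae (wForm_reflectPair s f.fn f.fn)

theorem inner_reflect (s : ℤ) (f g : LR R) :
    inner ℂ (reflect R s f) (reflect R s g) = inner ℂ g f :=
  integral_congr_ae (wForm_reflectPair s g.fn f.fn)

theorem reflect_ae (s : ℤ) (f : LR R) : ∀ᵐ x ∂mT,
    (reflect R s f).fn.1 x = fourier s x * conj (f.fn.2 x) ∧
    (reflect R s f).fn.2 x = fourier s x * conj (f.fn.1 x) := by
  filter_upwards [coeFn_fourierAE_mul_star s f.fn.1, coeFn_fourierAE_mul_star s f.fn.2]
    with x h1 h2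
  exact ⟨h2, h1⟩

theorem UR_ae (f : LR R) : ∀ᵐ x ∂mT,
    (UR R f).fn.1 x = fourier 1 x * f.fn.1 x ∧ (UR R f).fn.2 x = fourier 1 x * f.fn.2 x := by
  filter_upwards [AEEqFun.coeFn_mul tae f.fn.1, AEEqFun.coeFn_mul tae f.fn.2, coeFn_tae]
    with x h1 h2 h3
  rw [Pi.mul_apply, h3] at h1 h2
  exact ⟨h1, h2⟩

theorem fourier_mul_conj (s : ℤ) (x : T) : fourier s x * conj (fourier s x) = 1 := by
  rw [Complex.mul_conj', norm_fourier_apply]; norm_num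

theorem reflect_reflect (s : ℤ) (f : LR R) : reflect R s (reflect R s f) = f := by
  have key : ∀ᵐ x ∂mT, (reflect R s (reflect R s f)).fn.1 x = f.fn.1 x ∧
      (reflect R s (reflect R s f)).fn.2 x = f.fn.2 x := by
    filter_upwards [reflect_ae s (reflect R s f), reflect_ae s f] with x h1 h2
    rw [h1.1, h1.2, h2.1, h2.2, map_mul, map_mul, Complex.conj_conj, Complex.conj_conj,
      ← mul_assoc, ← mul_assoc, fourier_mul_conj, one_mul, one_mul]
    exact ⟨rfl, rfl⟩
  exact LR.ext_ae (key.mono fun x h => h.1) (key.mono fun x h => h.2)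

/-- Conjugation turns `t` into its inverse, so the reflection intertwines `U_R` with its inverse. In
this form no inverse of the isometry `UR` has to be named. -/
theorem UR_reflect_UR (s : ℤ) (f : LR R) : UR R (reflect R s (UR R f)) = reflect R s f := by
  have key : ∀ᵐ x ∂mT, (UR R (reflect R s (UR R f))).fn.1 x = (reflect R s f).fn.1 x ∧
      (UR R (reflect R s (UR R f))).fn.2 x = (reflect R s f).fn.2 x := by
    filter_upwards [UR_ae (reflect R s (UR R f)), reflect_ae s (UR R f), UR_ae f,
      reflect_ae s f] with x h1 h2 h3 h4
    rw [h1.1, h1.2, h2.1, h2.2, h3.1, h3.2, h4.1, h4.2, map_mul, map_mul]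
    constructor
    · linear_combination (fourier s x * conj (f.fn.2 x)) * fourier_mul_conj 1 x
    · linear_combination (fourier s x * conj (f.fn.1 x)) * fourier_mul_conj 1 x
  exact LR.ext_ae (key.mono fun x h => h.1) (key.mono fun x h => h.2)

theorem reflectLp_memLp (s : ℤ) (g : Lp ℂ 2 mT) :
    MemLp (fun x => fourier s x * conj (g x)) 2 mT :=
  (Lp.memLp g).mono ((fourier s).continuous.aestronglyMeasurable.mul
    (Complex.continuous_conj.comp_aestronglyMeasurable (Lp.memLp g).1))
    (Filter.Eventually.of_forall fun x => by
      rw [norm_mul, norm_fourier_apply, one_mul, RCLike.norm_conj])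

/-- The function `t ^ s conj g`. -/
def reflectLp (s : ℤ) (g : Lp ℂ 2 mT) : Lp ℂ 2 mT := (reflectLp_memLp s g).toLp

theorem fourierCoeff_mul_conj (s : ℤ) (g : T → ℂ) (k : ℤ) :
    fourierCoeff (fun x => fourier s x * conj (g x)) k = conj (fourierCoeff g (s - k)) := by
  unfold fourierCoeff
  rw [← integral_conj]
  congr 1
  ext x
  rw [smul_eq_mul, smul_eq_mul, map_mul, ← fourier_neg, neg_neg, ← mul_assoc, ← fourier_add,
    show -k + s = s - k by ring]

theorem fourierCoeff_reflectLp (s : ℤ) (g : Lp ℂ 2 mT) (k : ℤ) :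
    fourierCoeff (reflectLp s g) k = conj (fourierCoeff g (s - k)) := by
  rw [reflectLp, fourierCoeff_congr_ae (reflectLp_memLp s g).coeFn_toLp, fourierCoeff_mul_conj]

theorem reflectLp_zero (s : ℤ) : reflectLp s 0 = 0 := by
  refine Lp.ext ?_
  filter_upwards [(reflectLp_memLp s 0).coeFn_toLp, Lp.coeFn_zero ℂ 2 mT] with x h1 h2
  rw [reflectLp, h1, h2]
  simp

theorem reflectLp_fourierLp (s k : ℤ) :
    reflectLp s (fourierLp 2 k) = fourierLp 2 (s - k) := by
  refine Lp.ext ?_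
  filter_upwards [(reflectLp_memLp s (fourierLp 2 k)).coeFn_toLp,
    coeFn_fourierLp (T := 1) 2 k, coeFn_fourierLp (T := 1) 2 (s - k)] with x h1 h2 h3
  rw [reflectLp, h1, h2, h3, ← fourier_neg, ← fourier_add, sub_eq_add_neg]

theorem weightMap_ae (g : Lp ℂ 2 mT × Lp ℂ 2 mT) :
    ∀ᵐ x ∂mT, (weightMap R g).fn.1 x = g.1 x + conj (R.toFun x) * g.2 x ∧
      (weightMap R g).fn.2 x = R.toFun x * g.1 x + g.2 x :=
  weightPair_ae R g

theorem reflect_weightMap (s : ℤ) (g : Lp ℂ 2 mT × Lp ℂ 2 mT) :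
    reflect R s (weightMap R g) = weightMap R (reflectLp s g.2, reflectLp s g.1) := by
  have key : ∀ᵐ x ∂mT, (reflect R s (weightMap R g)).fn.1 x =
        (weightMap R (reflectLp s g.2, reflectLp s g.1)).fn.1 x ∧
      (reflect R s (weightMap R g)).fn.2 x =
        (weightMap R (reflectLp s g.2, reflectLp s g.1)).fn.2 x := by
    filter_upwards [reflect_ae s (weightMap R g), weightMap_ae (R := R) g,
      weightMap_ae (R := R) (reflectLp s g.2, reflectLp s g.1),
      (reflectLp_memLp s g.1).coeFn_toLp, (reflectLp_memLp s g.2).coeFn_toLp]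
      with x h1 h2 h3 h4 h5
    rw [h1.1, h1.2, h2.1, h2.2, h3.1, h3.2]
    simp only [reflectLp, h4, h5, map_add, map_mul, Complex.conj_conj]
    constructor <;> ring
  exact LR.ext_ae (key.mono fun x h => h.1) (key.mono fun x h => h.2)

theorem reflect_e (s n : ℤ) : reflect R s (e R n) = d R (n - 1 - s) := by
  rw [e, d, reflect_weightMap, reflectLp_zero, reflectLp_fourierLp]
  congr 3; ring

/-- Conjugation followed by `t ^ s` sends frequency `k` to `s - k`, so the conditions `k < n` and `k
≥ -m` on vanishing coefficients trade places. The sum of the two indices is preserved. -/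
theorem reflect_mem (s : ℤ) {n m n' m' : ℤ} (hn : n' = m + 1 + s) (hm : m' = n - 1 - s)
    {f : LR R} (hf : f ∈ checkH R n m) : reflect R s f ∈ checkH R n' m' := by
  subst hn hm
  refine map_mem_closure (reflect R s).continuous hf ?_
  rintro _ ⟨g, hg, rfl⟩
  refine ⟨(reflectLp s g.2, reflectLp s g.1), ⟨fun k hk => ?_, fun k hk => ?_⟩,
    (reflect_weightMap s g).symm⟩
  · rw [fourierCoeff_reflectLp, hg.2 _ (by omega), map_zero]
  · rw [fourierCoeff_reflectLp, hg.1 _ (by omega), map_zero]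

theorem UR_reflect_UR_reflect (s : ℤ) (f : LR R) :
    UR R (reflect R s (UR R (reflect R s f))) = f := by
  rw [UR_reflect_UR, reflect_reflect]

/-- The inverse of `U_R` is its conjugate by the reflection with `s = 0`. -/
theorem exists_UR_eq {n m : ℤ} {f : LR R} (hf : f ∈ checkH R (n + 1) m) :
    ∃ g ∈ checkH R n (m + 1), UR R g = f := by
  refine ⟨reflect R 0 (UR R (reflect R 0 f)), ?_, UR_reflect_UR_reflect 0 f⟩
  have h1 : reflect R 0 f ∈ checkH R (m + 1) (n - 1 + 1) :=
    reflect_mem 0 (by ring) (by ring) hf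
  exact reflect_mem 0 (by ring) (by ring) (UR_mem R h1)

/-! ### Orthogonal projections onto the spaces `H_{n,m}` -/

theorem starProjection_UR (n m : ℤ) (f : LR R) :
    (checkH R (n + 1) m).starProjection (UR R f) =
      UR R ((checkH R n (m + 1)).starProjection f) := by
  refine Submodule.eq_starProjection_of_mem_of_inner_eq_zero
    (UR_mem R (Submodule.starProjection_apply_mem _ _)) fun w hw => ?_
  obtain ⟨g, hg, rfl⟩ := exists_UR_eq hw
  rw [← map_sub, LinearIsometry.inner_map_map]
  exact Submodule.starProjection_inner_eq_zero _ _ hg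

theorem starProjection_reflect (s : ℤ) {n m n' m' : ℤ} (hn : n' = m + 1 + s)
    (hm : m' = n - 1 - s) (f : LR R) :
    (checkH R n' m').starProjection (reflect R s f) =
      reflect R s ((checkH R n m).starProjection f) := by
  refine Submodule.eq_starProjection_of_mem_of_inner_eq_zero
    (reflect_mem s hn hm (Submodule.starProjection_apply_mem _ _)) fun w hw => ?_
  have hw' : reflect R s w ∈ checkH R n m := reflect_mem s (by omega) (by omega) hw
  rw [← reflect_reflect s w, ← map_sub, inner_reflect, inner_eq_zero_symm]
  exact Submodule.starProjection_inner_eq_zero _ _ hw'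

variable (R) in
/-- The operator `f ↦ U_R (P f)` on `L^R`, `P` being the orthogonal projection onto `H_{n,m+1}`. -/
def compression (n m : ℤ) : LR R →L[ℂ] LR R :=
  (UR R).toContinuousLinearMap ∘L (checkH R n (m + 1)).starProjection

theorem compression_apply (n m : ℤ) (f : LR R) :
    compression R n m f = UR R ((checkH R n (m + 1)).starProjection f) := rfl

/-- The reflection carries a compression to the adjoint of the compression at the reflected indices.
The projection is moved across `U_R` (`starProjection_UR`), then across the inner product, then
across the reflection; finally `U_R` is absorbed by `UR_reflect_UR`. -/
theorem inner_compression_reflect (s : ℤ) {n m n' m' : ℤ} (hn : n' = m + 1 + s)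
    (hm : m' = n - 1 - s) (f g : LR R) :
    inner ℂ (compression R n' m' f) (reflect R s g) =
      inner ℂ f (reflect R s (compression R n m g)) := by
  have h1 : inner ℂ f (reflect R s (compression R n m g)) =
      inner ℂ (UR R f) (reflect R s ((checkH R n (m + 1)).starProjection g)) := by
    rw [← LinearIsometry.inner_map_map (UR R), compression_apply, UR_reflect_UR]
  rw [h1, ← starProjection_reflect s (n' := n' + 1) (m' := m') (by omega) (by omega),
    ← Submodule.inner_starProjection_left_eq_right, starProjection_UR, compression_apply]

theorem inner_compression_pow_reflect (s : ℤ) {n m n' m' : ℤ} (hn : n' = m + 1 + s)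
    (hm : m' = n - 1 - s) (k : ℕ) (f g : LR R) :
    inner ℂ ((compression R n' m' ^ k) f) (reflect R s g) =
      inner ℂ f (reflect R s ((compression R n m ^ k) g)) := by
  induction k generalizing f g with
  | zero => simp
  | succ k ih =>
    rw [pow_succ', pow_succ, mul_apply_eq_comp, mul_apply_eq_comp,
      inner_compression_reflect s hn hm, ih]

end

section

variable {R : SzegoFunction}

/-! ### One-dimensional subspaces of a Hilbert space and normalized unit vectors -/

section UnitVector

variable {E : Type*} [NormedAddCommGroup E] [InnerProductSpace ℂ E] {D : Submodule ℂ E} {v : E}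

/-- The hypothesis `hv` makes the functional `⟨v, ·⟩` injective on `D`, so `D` is at most
one-dimensional and any unit vector spans it. -/
theorem eq_inner_smul_of_unit (hv : ∀ x ∈ D, inner ℂ v x = 0 → x = 0) {q : E} (hq : q ∈ D)
    (hq1 : ‖q‖ = 1) {x : E} (hx : x ∈ D) : x = inner ℂ q x • q := by
  have hvq : inner ℂ v q ≠ 0 := fun h => by
    have := hv q hq h
    rw [this, norm_zero] at hq1
    exact zero_ne_one hq1
  have h1 : x - (inner ℂ v x / inner ℂ v q) • q = 0 := by
    refine hv _ (D.sub_mem hx (D.smul_mem _ hq)) ?_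
    rw [inner_sub_right, inner_smul_right, div_mul_cancel₀ _ hvq, sub_self]
  have h2 : inner ℂ q x = inner ℂ v x / inner ℂ v q := by
    rw [sub_eq_zero] at h1
    conv_lhs => rw [h1]
    rw [inner_smul_right, inner_self_eq_norm_sq_to_K, hq1]
    simp
  rw [h2]
  exact sub_eq_zero.1 h1

theorem unit_unique (hv : ∀ x ∈ D, inner ℂ v x = 0 → x = 0) {q q' : E} (hq : q ∈ D)
    (hq' : q' ∈ D) (hq1 : ‖q‖ = 1) (hq1' : ‖q'‖ = 1)
    (hpos : ∃ r : ℝ, 0 < r ∧ inner ℂ q v = r) (hpos' : ∃ r : ℝ, 0 < r ∧ inner ℂ q' v = r) :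
    q' = q := by
  obtain ⟨r, hr, h⟩ := hpos
  obtain ⟨r', hr', h'⟩ := hpos'
  have h1 := eq_inner_smul_of_unit hv hq hq1 hq'
  set b := inner ℂ q q' with hb
  have hb1 : ‖b‖ = 1 := by
    have := congrArg norm h1
    rw [norm_smul, hq1, hq1', mul_one] at this
    exact this.symm
  have h2 : (r' : ℂ) = conj b * r := by
    rw [← h', ← h]
    conv_lhs => rw [h1]
    rw [inner_smul_left]
  have h3 : r' = r := by
    have := congrArg norm h2
    rw [norm_mul, RCLike.norm_conj, hb1, one_mul, Complex.norm_real, Complex.norm_real,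
      Real.norm_of_nonneg hr.le, Real.norm_of_nonneg hr'.le] at this
    exact this
  have h4 : conj b = 1 := by
    have h0 : (r : ℂ) ≠ 0 := by exact_mod_cast hr.ne'
    rw [h3] at h2
    exact (mul_right_cancel₀ h0 (by rw [one_mul]; exact h2)).symm
  have h5 : b = 1 := by rw [← Complex.conj_conj b, h4, map_one]
  rw [h1, h5, one_smul]

theorem exists_unit {x : E} (hx : x ∈ D) (hvx : inner ℂ v x ≠ 0) :
    ∃ q ∈ D, ‖q‖ = 1 ∧ ∃ r : ℝ, 0 < r ∧ inner ℂ q v = r := by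
  have hx0 : x ≠ 0 := fun h => hvx (by rw [h, inner_zero_right])
  have hn : 0 < ‖x‖ := norm_pos_iff.2 hx0
  have ha : 0 < ‖inner ℂ v x‖ := norm_pos_iff.2 hvx
  -- The scalar rotates `x` by the phase that makes its pairing with `v` positive, and divides by
  -- the norm.
  refine ⟨(conj (inner ℂ v x) / ((‖inner ℂ v x‖ * ‖x‖ : ℝ) : ℂ)) • x, D.smul_mem _ hx, ?_,
    ‖inner ℂ v x‖ / ‖x‖, div_pos ha hn, ?_⟩
  · rw [norm_smul, norm_div, RCLike.norm_conj, Complex.norm_real, Real.norm_of_nonneg (by positivity)]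
    field_simp
  · rw [inner_smul_left, map_div₀, Complex.conj_conj, Complex.conj_ofReal, ← inner_conj_symm x v,
      div_mul_eq_mul_div, Complex.mul_conj']
    push_cast
    have h1 : ((‖inner ℂ v x‖ : ℝ) : ℂ) ≠ 0 := by exact_mod_cast ha.ne'
    have h2 : ((‖x‖ : ℝ) : ℂ) ≠ 0 := by exact_mod_cast hn.ne'
    field_simp

theorem inner_sub_starProjection (M : Submodule ℂ E) [M.HasOrthogonalProjection] (v : E) :
    inner ℂ v (v - M.starProjection v) = ((‖v - M.starProjection v‖ ^ 2 : ℝ) : ℂ) := by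
  have h : inner ℂ (M.starProjection v) (v - M.starProjection v) = 0 := by
    rw [inner_eq_zero_symm]
    exact Submodule.starProjection_inner_eq_zero _ _ (Submodule.starProjection_apply_mem _ _)
  have h2 : inner ℂ (v - M.starProjection v) (v - M.starProjection v) =
      inner ℂ v (v - M.starProjection v) := by
    conv_lhs => rw [inner_sub_left, h, sub_zero]
  rw [← h2, inner_self_eq_norm_sq_to_K]
  simp

theorem inner_sub_starProjection_ne_zero {M : Submodule ℂ E} [M.HasOrthogonalProjection] {v : E}
    (hv : v ∉ M) : inner ℂ v (v - M.starProjection v) ≠ 0 := by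
  rw [inner_sub_starProjection]
  have : v - M.starProjection v ≠ 0 := fun h => hv (by
    rw [sub_eq_zero.1 h]; exact Submodule.starProjection_apply_mem _ _)
  have := norm_pos_iff.2 this
  exact_mod_cast (pow_pos this 2).ne'

end UnitVector

/-! ### The spaces `Δ_{n,m}` and `Δ~_{n,m}` are one-dimensional -/

/-- Removing the `n`-th Fourier term from the first component leaves an element of `H_{n+1,m}`. So
`f` is orthogonal to all of `H_{n,m}`, to which it belongs. -/
theorem eq_zero_of_inner_e {n m : ℤ} {f : LR R} (hf : f ∈ checkDelta R n m)
    (h0 : inner ℂ (e R n) f = 0) : f = 0 := by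
  have key : f ∈ (checkH R n m)ᗮ := by
    rw [checkH, Submodule.orthogonal_closure, Submodule.mem_orthogonal]
    rintro _ ⟨g, hg, rfl⟩
    set c := fourierCoeff g.1 n
    have h1 : weightMap R g = c • e R n + weightMap R (g.1 - c • fourierLp 2 n, g.2) := by
      rw [e, ← map_smul, ← map_add]
      congr 1
      refine Prod.ext ?_ ?_ <;> simp
    have h2 : weightMap R (g.1 - c • fourierLp 2 n, g.2) ∈ checkH R (n + 1) m := by
      refine Submodule.le_topologicalClosure _ (Submodule.mem_map_of_mem ⟨fun k hk => ?_, hg.2⟩)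
      change fourierCoeff (g.1 - c • fourierLp 2 n : Lp ℂ 2 mT) k = 0
      rw [sub_eq_add_neg, ← neg_smul, fourierCoeff_Lp_add, fourierCoeff_Lp_smul,
        fourierCoeff_fourierLp]
      rcases eq_or_ne k n with rfl | hkn
      · simp [c]
      · rw [hg.1 k (by omega), if_neg hkn]; simp
    rw [h1, inner_add_left, inner_smul_left, h0, mul_zero, zero_add]
    exact hf.2 _ h2
  exact inner_self_eq_zero.1 (key f hf.1)

theorem reflect_mem_orthogonal (s : ℤ) {n m n' m' : ℤ} (hn : n' = m + 1 + s) (hm : m' = n - 1 - s)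
    {f : LR R} (hf : f ∈ (checkH R n m)ᗮ) : reflect R s f ∈ (checkH R n' m')ᗮ := by
  intro w hw
  rw [← reflect_reflect s w, inner_reflect, inner_eq_zero_symm]
  exact hf _ (reflect_mem s (by omega) (by omega) hw)

theorem reflect_mem_checkDeltaT (s : ℤ) {n m n' m' : ℤ} (hn : n' = m + 1 + s)
    (hm : m' = n - 1 - s) {f : LR R} (hf : f ∈ checkDelta R n m) :
    reflect R s f ∈ checkDeltaT R n' m' :=
  ⟨reflect_mem s hn hm hf.1, reflect_mem_orthogonal s hn (by omega) hf.2⟩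

theorem reflect_mem_checkDelta (s : ℤ) {n m n' m' : ℤ} (hn : n' = m + 1 + s)
    (hm : m' = n - 1 - s) {f : LR R} (hf : f ∈ checkDeltaT R n m) :
    reflect R s f ∈ checkDelta R n' m' :=
  ⟨reflect_mem s hn hm hf.1, reflect_mem_orthogonal s (by omega) hm hf.2⟩

theorem reflect_d (s m : ℤ) : reflect R s (d R m) = e R (m + 1 + s) := by
  rw [← reflect_reflect s (e R (m + 1 + s)), reflect_e]
  congr 2; ring

theorem eq_zero_of_inner_d {n m : ℤ} {f : LR R} (hf : f ∈ checkDeltaT R n m)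
    (h0 : inner ℂ (d R m) f = 0) : f = 0 := by
  have h1 : reflect R 0 f ∈ checkDelta R (m + 1 + 0) (n - 1 - 0) :=
    reflect_mem_checkDelta 0 rfl rfl hf
  have h2 := eq_zero_of_inner_e h1 (by
    rw [← reflect_d, inner_reflect, inner_eq_zero_symm]; exact h0)
  rw [← reflect_reflect 0 f, h2, map_zero]

theorem sub_starProjection_mem_checkDelta {n m : ℤ} {f : LR R} (hf : f ∈ checkH R n m) :
    f - (checkH R (n + 1) m).starProjection f ∈ checkDelta R n m :=
  ⟨Submodule.sub_mem _ hf (checkH_le R (by omega) le_rfl (Submodule.starProjection_apply_mem _ _)),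
    Submodule.sub_starProjection_mem_orthogonal _⟩

theorem sub_starProjection_mem_checkDeltaT {n m : ℤ} {f : LR R} (hf : f ∈ checkH R n m) :
    f - (checkH R n (m + 1)).starProjection f ∈ checkDeltaT R n m :=
  ⟨Submodule.sub_mem _ hf (checkH_le R le_rfl (by omega) (Submodule.starProjection_apply_mem _ _)),
    Submodule.sub_starProjection_mem_orthogonal _⟩

section Dilation

variable {n m : ℤ} {K : checkDelta R n m} {Kt : checkDeltaT R n m}

theorem starProjection_add_inner_smul (hK : ‖(K : LR R)‖ = 1) {f : LR R}
    (hf : f ∈ checkH R n m) :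
    (checkH R (n + 1) m).starProjection f + inner ℂ (K : LR R) f • (K : LR R) = f := by
  have h := eq_inner_smul_of_unit (fun x => eq_zero_of_inner_e) K.2 hK
    (sub_starProjection_mem_checkDelta hf)
  rw [inner_sub_right, inner_eq_zero_symm.1 (K.2.2 _ (Submodule.starProjection_apply_mem _ _)),
    sub_zero] at h
  rw [← h, add_sub_cancel]

theorem starProjection_add_inner_smul' (hKt : ‖(Kt : LR R)‖ = 1) {f : LR R}
    (hf : f ∈ checkH R n m) :
    (checkH R n (m + 1)).starProjection f + inner ℂ (Kt : LR R) f • (Kt : LR R) = f := by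
  have h := eq_inner_smul_of_unit (fun x => eq_zero_of_inner_d) Kt.2 hKt
    (sub_starProjection_mem_checkDeltaT hf)
  rw [inner_sub_right, inner_eq_zero_symm.1 (Kt.2.2 _ (Submodule.starProjection_apply_mem _ _)),
    sub_zero] at h
  rw [← h, add_sub_cancel]

/-! ### The dilation is unitary -/

theorem norm_sq_ell2 (x : ell2) : ‖x‖ ^ 2 = ‖x 0‖ ^ 2 + ‖shiftLeft x‖ ^ 2 := by
  have h1 := lp.hasSum_norm (p := 2) (by norm_num) x
  have h2 := lp.hasSum_norm (p := 2) (by norm_num) (shiftLeft x)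
  rw [← hasSum_nat_add_iff' 1] at h1
  have h3 := h1.unique h2
  simp only [ENNReal.toReal_ofNat, Real.rpow_ofNat, Finset.sum_range_one] at h3
  linarith

theorem shiftLeft_shiftRight (c : ℂ) (y : ell2) :
    shiftLeft (c • lp.single 2 0 (1 : ℂ) + shiftRight y) = y := by
  refine lp.ext (funext fun j => ?_)
  change c • (lp.single (E := fun _ : ℕ => ℂ) 2 0 (1 : ℂ)) (j + 1) + y j = y j
  rw [lp.single_apply]
  simp

theorem cons_zero (c : ℂ) (y : ell2) :
    (c • lp.single 2 0 (1 : ℂ) + shiftRight y : ell2) 0 = c := by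
  change c • (lp.single (E := fun _ : ℕ => ℂ) 2 0 (1 : ℂ)) 0 + 0 = c
  rw [lp.single_apply]
  simp

theorem dilU_apply (K : checkDelta R n m) (Kt : checkDeltaT R n m) (v : Dil R n m) :
    dilU K Kt v = WithLp.toLp 2 (shiftLeft v.fst, WithLp.toLp 2
      (A0 R n m v.snd.fst + v.fst 0 • inH K,
        (inner ℂ (inHT Kt) v.snd.fst) • lp.single 2 0 (1 : ℂ) + shiftRight v.snd.snd)) := rfl

theorem coe_A0 (h : checkH R n m) : (A0 R n m h : LR R) = compression R n m h := rfl

theorem norm_sq_dil (v : Dil R n m) :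
    ‖v‖ ^ 2 = ‖v.fst‖ ^ 2 + (‖v.snd.fst‖ ^ 2 + ‖v.snd.snd‖ ^ 2) := by
  rw [WithLp.prod_norm_sq_eq_of_L2, WithLp.prod_norm_sq_eq_of_L2]

theorem norm_sq_dil_mk (x y : ell2) (h : checkH R n m) :
    ‖(WithLp.toLp 2 (x, WithLp.toLp 2 (h, y)) : Dil R n m)‖ ^ 2 =
      ‖x‖ ^ 2 + (‖h‖ ^ 2 + ‖y‖ ^ 2) :=
  norm_sq_dil _

/-- The operator `U_R` maps `H_{n,m+1}` into `H_{n+1,m}`, which is orthogonal to `K`, and `H_{n,m}`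
is the orthogonal sum of `H_{n,m+1}` and the line of `K~`. The two outer sequences are merely
shifted. -/
theorem norm_dilU (hK : ‖(K : LR R)‖ = 1) (hKt : ‖(Kt : LR R)‖ = 1) (v : Dil R n m) :
    ‖dilU K Kt v‖ = ‖v‖ := by
  rw [← sq_eq_sq₀ (norm_nonneg _) (norm_nonneg _), dilU_apply, norm_sq_dil_mk,
    norm_sq_dil, norm_sq_ell2 v.fst, norm_sq_ell2 (_ + shiftRight _), cons_zero, shiftLeft_shiftRight]
  set h := v.snd.fst
  have h1 : ‖A0 R n m h + v.fst 0 • inH K‖ ^ 2 =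
      ‖(checkH R n (m + 1)).starProjection (h : LR R)‖ ^ 2 + ‖v.fst 0‖ ^ 2 := by
    rw [← Submodule.norm_coe, Submodule.coe_add, Submodule.coe_smul, coe_A0, compression_apply]
    have ho : inner ℂ (UR R ((checkH R n (m + 1)).starProjection (h : LR R)))
        (v.fst 0 • (inH K : LR R)) = 0 := by
      rw [inner_smul_right]
      exact mul_eq_zero_of_right _
        (K.2.2 _ (UR_mem R (Submodule.starProjection_apply_mem _ _)))
    have := norm_add_sq_eq_norm_sq_add_norm_sq_of_inner_eq_zero _ _ ho
    rw [pow_two, this, LinearIsometry.norm_map, norm_smul,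
      show ‖(inH K : LR R)‖ = 1 from hK]
    ring
  have h2 : ‖h‖ ^ 2 = ‖(checkH R n (m + 1)).starProjection (h : LR R)‖ ^ 2 +
      ‖inner ℂ (inHT Kt) h‖ ^ 2 := by
    have ho : inner ℂ ((checkH R n (m + 1)).starProjection (h : LR R))
        (inner ℂ (Kt : LR R) (h : LR R) • (Kt : LR R)) = 0 := by
      rw [inner_smul_right]
      exact mul_eq_zero_of_right _ (Kt.2.2 _ (Submodule.starProjection_apply_mem _ _))
    have := norm_add_sq_eq_norm_sq_add_norm_sq_of_inner_eq_zero _ _ ho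
    rw [starProjection_add_inner_smul' hKt h.2, norm_smul, hKt, mul_one] at this
    rw [← Submodule.norm_coe, pow_two, this, pow_two, pow_two]
    rfl
  rw [h1, h2]
  ring

theorem dilU_surjective (hK : ‖(K : LR R)‖ = 1) (hKt : ‖(Kt : LR R)‖ = 1) :
    Function.Surjective (dilU K Kt) := by
  intro v
  -- The preimage runs the colligation backwards: the part in `H_{n+1,m}` is pulled back by `U_R`,
  -- the coefficient `a` along `K` becomes the new incoming entry, and the first outgoing entry `b`
  -- returns as the coefficient of `K~`.
  obtain ⟨g, hg, hgv⟩ := exists_UR_eq (n := n) (m := m)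
    (Submodule.starProjection_apply_mem (checkH R (n + 1) m) (v.snd.fst : LR R))
  set a := inner ℂ (K : LR R) (v.snd.fst : LR R) with ha
  set b := v.snd.snd 0 with hb
  set h : checkH R n m := ⟨g, checkH_le R le_rfl (by omega) hg⟩ + b • inHT Kt with hh
  have hcoe : (h : LR R) = g + b • (Kt : LR R) := rfl
  have hP : (checkH R n (m + 1)).starProjection (h : LR R) = g := by
    rw [hcoe, map_add, map_smul, Submodule.starProjection_eq_self_iff.2 hg,
      (Submodule.starProjection_apply_eq_zero_iff _).2 Kt.2.2, smul_zero, add_zero]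
  refine ⟨WithLp.toLp 2 (a • lp.single 2 0 (1 : ℂ) + shiftRight v.fst,
    WithLp.toLp 2 (h, shiftLeft v.snd.snd)), ?_⟩
  rw [dilU_apply]
  have e1 : A0 R n m h + a • inH K = v.snd.fst := by
    refine Subtype.ext ?_
    rw [Submodule.coe_add, Submodule.coe_smul, coe_A0, compression_apply, hP, hgv]
    exact starProjection_add_inner_smul hK v.snd.fst.2
  have e2 : inner ℂ (inHT Kt) h = b := by
    change inner ℂ (Kt : LR R) (g + b • (Kt : LR R)) = b
    rw [inner_add_right, inner_eq_zero_symm.1 (Kt.2.2 _ hg), inner_smul_right,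
      inner_self_eq_norm_sq_to_K, hKt]
    simp
  have e3 : b • lp.single 2 0 (1 : ℂ) + shiftRight (shiftLeft v.snd.snd) = v.snd.snd := by
    refine lp.ext (funext fun j => ?_)
    cases j with
    | zero => exact cons_zero b _
    | succ j => exact congrFun (congrArg Subtype.val (shiftLeft_shiftRight b (shiftLeft v.snd.snd))) j
  change WithLp.toLp 2 (shiftLeft (a • lp.single 2 0 (1 : ℂ) + shiftRight v.fst), WithLp.toLp 2
      (A0 R n m h + (a • lp.single 2 0 (1 : ℂ) + shiftRight v.fst : ell2) 0 • inH K,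
        (inner ℂ (inHT Kt) h) • lp.single 2 0 (1 : ℂ) + shiftRight (shiftLeft v.snd.snd))) = v
  rw [shiftLeft_shiftRight, cons_zero, e1, e2, e3]
  rfl

theorem dilU_mem_unitary (hK : ‖(K : LR R)‖ = 1) (hKt : ‖(Kt : LR R)‖ = 1) :
    dilU K Kt ∈ unitary (Dil R n m →L[ℂ] Dil R n m) := by
  have h1 : ContinuousLinearMap.adjoint (dilU K Kt) ∘L dilU K Kt = 1 :=
    (ContinuousLinearMap.norm_map_iff_adjoint_comp_self _).1 (norm_dilU hK hKt)
  refine Unitary.mem_iff.2 ⟨h1, ?_⟩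
  ext1 y
  obtain ⟨x, rfl⟩ := dilU_surjective hK hKt y
  change dilU K Kt ((ContinuousLinearMap.adjoint (dilU K Kt) ∘L dilU K Kt) x) = _
  rw [h1]
  rfl

end Dilation

/-! ### Integer powers of unitary operators -/

section Upow

variable {E : Type*} [NormedAddCommGroup E] [InnerProductSpace ℂ E] [CompleteSpace E]
  {A : E →L[ℂ] E}

/-- For a unitary operator the adjoint powers are inverse powers, which gives access to the group
law for integer exponents. -/
theorem upow_eq_zpow (hA : A ∈ unitary (E →L[ℂ] E)) (k : ℤ) :
    upow A k = (((⟨A, hA⟩ : unitary (E →L[ℂ] E)) ^ k : unitary (E →L[ℂ] E)) : E →L[ℂ] E) := by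
  cases k with
  | ofNat k => simp [upow]
  | negSucc k =>
    rw [zpow_negSucc, ← Unitary.star_eq_inv]
    simp [upow, ContinuousLinearMap.star_eq_adjoint]

theorem upow_add (hA : A ∈ unitary (E →L[ℂ] E)) (j k : ℤ) (x : E) :
    upow A (j + k) x = upow A j (upow A k x) := by
  simp only [upow_eq_zpow hA, zpow_add]
  rfl

theorem upow_natCast (A : E →L[ℂ] E) (k : ℕ) : upow A (k : ℤ) = A ^ k := rfl

theorem inner_upow (hA : A ∈ unitary (E →L[ℂ] E)) (j : ℤ) (x y : E) :
    inner ℂ (upow A j x) y = inner ℂ x (upow A (-j) y) := by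
  rw [upow_eq_zpow hA, upow_eq_zpow hA, zpow_neg, ← Unitary.star_eq_inv, Unitary.coe_star,
    ContinuousLinearMap.star_eq_adjoint, ContinuousLinearMap.adjoint_inner_right]

end Upow

/-! ### The Fourier coefficients of the scattering functions -/

section Scattering

variable {n m : ℤ} {K : checkDelta R n m} {Kt : checkDeltaT R n m}

/-- Without incoming entries nothing is fed back into `H_{n,m}`: the state evolves by the
compression alone, and what it loses leaves through the outgoing channel. -/
theorem dilU_pow_emb (K : checkDelta R n m) (Kt : checkDeltaT R n m) (k : ℕ) (h : checkH R n m) :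
    ∃ (g : checkH R n m) (y : ell2), (g : LR R) = (compression R n m ^ k) h ∧
      (dilU K Kt ^ k) (emb h) = WithLp.toLp 2 (0, WithLp.toLp 2 (g, y)) := by
  induction k with
  | zero => exact ⟨h, 0, rfl, rfl⟩
  | succ k ih =>
    obtain ⟨g, y, hg, hy⟩ := ih
    refine ⟨A0 R n m g, (inner ℂ (inHT Kt) g) • lp.single 2 0 (1 : ℂ) + shiftRight y, ?_, ?_⟩
    · rw [coe_A0, hg, pow_succ', mul_apply_eq_comp]
    · rw [pow_succ', mul_apply_eq_comp, hy, dilU_apply]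
      change WithLp.toLp 2 (shiftLeft 0, WithLp.toLp 2 (A0 R n m g + (0 : ℂ) • inH K, _)) = _
      rw [map_zero, zero_smul, add_zero]
      rfl

theorem inner_emb_dilU_pow (K : checkDelta R n m) (Kt : checkDeltaT R n m) (k : ℕ)
    (h h' : checkH R n m) :
    inner ℂ (emb h') ((dilU K Kt ^ k) (emb h)) =
      inner ℂ (h' : LR R) ((compression R n m ^ k) h) := by
  obtain ⟨g, y, hg, hy⟩ := dilU_pow_emb K Kt k h
  rw [hy, ← hg, emb, WithLp.prod_inner_apply, WithLp.prod_inner_apply]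
  simp

theorem inner_dilU_pow_emb (K : checkDelta R n m) (Kt : checkDeltaT R n m) (k : ℕ)
    (h h' : checkH R n m) :
    inner ℂ ((dilU K Kt ^ k) (emb h)) (emb h') =
      inner ℂ ((compression R n m ^ k) h) (h' : LR R) := by
  obtain ⟨g, y, hg, hy⟩ := dilU_pow_emb K Kt k h
  rw [hy, ← hg, emb, WithLp.prod_inner_apply, WithLp.prod_inner_apply]
  simp

theorem s1coeff_eq (hK : ‖(K : LR R)‖ = 1) (hKt : ‖(Kt : LR R)‖ = 1) (k : ℤ) :
    s1coeff K Kt (k - n) = inner ℂ (emb (inH K))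
      (upow (dilU K Kt) (-k) (emb ⟨e R n, e_mem R n m⟩)) := by
  rw [s1coeff, psi, psi', ← upow_add (dilU_mem_unitary hK hKt)]
  congr 3; ring

theorem s2coeff_eq (hK : ‖(K : LR R)‖ = 1) (hKt : ‖(Kt : LR R)‖ = 1) (k : ℤ) :
    s2coeff K Kt (k - m) = inner ℂ (emb ⟨d R m, d_mem R n m⟩)
      (upow (dilU K Kt) (-k) (emb (inHT Kt))) := by
  have hU := dilU_mem_unitary hK hKt
  have h1 : psiT K Kt = upow (dilU K Kt) 1 (emb (inHT Kt)) := by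
    rw [psiT, ← Nat.cast_one, upow_natCast, pow_one]
  rw [s2coeff, h1, psi'', inner_upow hU, ← upow_add hU, ← upow_add hU]
  congr 3; ring

theorem s1coeff_sub_natCast (hK : ‖(K : LR R)‖ = 1) (hKt : ‖(Kt : LR R)‖ = 1) (k : ℕ) :
    s1coeff K Kt (k - n) = inner ℂ ((compression R n m ^ k) K) (e R n) := by
  rw [s1coeff_eq hK hKt, ← inner_upow (dilU_mem_unitary hK hKt), upow_natCast,
    inner_dilU_pow_emb]
  rfl

theorem s2coeff_sub_natCast (hK : ‖(K : LR R)‖ = 1) (hKt : ‖(Kt : LR R)‖ = 1) (k : ℕ) :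
    s2coeff K Kt (k - m) = inner ℂ ((compression R n m ^ k) (d R m)) (Kt : LR R) := by
  rw [s2coeff_eq hK hKt, ← inner_upow (dilU_mem_unitary hK hKt), upow_natCast,
    inner_dilU_pow_emb]
  rfl

theorem compression_pow_succ_mem (n m : ℤ) (k : ℕ) (f : LR R) :
    (compression R n m ^ (k + 1)) f ∈ checkH R (n + 1) m := by
  rw [pow_succ', mul_apply_eq_comp, compression_apply]
  exact UR_mem R (Submodule.starProjection_apply_mem _ _)

/-- Positive powers of the compression have range in `H_{n+1,m}`, which is orthogonal to `K`. -/
theorem s1coeff_sub_of_neg (hK : ‖(K : LR R)‖ = 1) (hKt : ‖(Kt : LR R)‖ = 1) {k : ℤ}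
    (hk : k < 0) : s1coeff K Kt (k - n) = 0 := by
  obtain ⟨j, rfl⟩ : ∃ j : ℕ, k = -((j + 1 : ℕ) : ℤ) := ⟨(-k - 1).toNat, by omega⟩
  rw [s1coeff_eq hK hKt, neg_neg, upow_natCast, inner_emb_dilU_pow, inner_eq_zero_symm]
  exact K.2.2 _ (compression_pow_succ_mem n m j _)

/-- The compression annihilates `K~`, since its first factor projects onto `H_{n,m+1}`. -/
theorem s2coeff_sub_of_neg (hK : ‖(K : LR R)‖ = 1) (hKt : ‖(Kt : LR R)‖ = 1) {k : ℤ}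
    (hk : k < 0) : s2coeff K Kt (k - m) = 0 := by
  obtain ⟨j, rfl⟩ : ∃ j : ℕ, k = -((j + 1 : ℕ) : ℤ) := ⟨(-k - 1).toNat, by omega⟩
  rw [s2coeff_eq hK hKt, neg_neg, upow_natCast, inner_emb_dilU_pow, pow_succ,
    mul_apply_eq_comp, compression_apply,
    show ((inHT Kt : checkH R n m) : LR R) = Kt from rfl,
    (Submodule.starProjection_apply_eq_zero_iff _).2 Kt.2.2, map_zero, map_zero,
    inner_zero_right]

theorem harmonicExt_zero (c : ℤ → ℂ) : harmonicExt c 0 = c 0 := by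
  rw [harmonicExt, tsum_eq_single 0]
  · simp
  · intro k hk
    have : k.natAbs ≠ 0 := by omega
    simp [this]

theorem checkA_zero (hK : ‖(K : LR R)‖ = 1) (hKt : ‖(Kt : LR R)‖ = 1) :
    checkA K Kt 0 = inner ℂ (K : LR R) (e R n) := by
  rw [checkA, harmonicExt_zero]
  exact s1coeff_sub_natCast hK hKt 0

theorem checkA'_zero (hK : ‖(K : LR R)‖ = 1) (hKt : ‖(Kt : LR R)‖ = 1) :
    checkA' K Kt 0 = inner ℂ (d R m) (Kt : LR R) := by
  rw [checkA', harmonicExt_zero]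
  exact s2coeff_sub_natCast hK hKt 0

end Scattering

end

section

/-! ### Jensen's inequality on the circle -/

theorem volume_eq_mT : (volume : Measure T) = mT := by
  rw [AddCircle.volume_eq_smul_haarAddCircle]
  simp

theorem fourier_one_coe (x : ℝ) : fourier 1 (x : T) = circleMap 0 1 (2 * Real.pi * x) := by
  rw [fourier_coe_apply, circleMap]
  push_cast
  rw [zero_add, one_mul]
  congr 1
  ring

instance : NullSingletonClass mT where
  measure_singleton x := by
    rw [← volume_eq_mT, ← Metric.closedBall_zero, AddCircle.volume_closedBall]
    simp

theorem ae_eval_fourier_ne_zero {q : Polynomial ℂ} (hq : q ≠ 0) :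
    ∀ᵐ x ∂mT, q.eval (fourier 1 x) ≠ 0 := by
  rw [ae_iff]
  refine Set.Finite.measure_zero ?_ _
  refine Set.Finite.of_finite_image (f := fun x : T => fourier 1 x) ?_ ?_
  · refine (Multiset.finite_toSet q.roots).subset ?_
    rintro _ ⟨x, hx, rfl⟩
    simpa [hq] using hx
  · intro x _ y _ h
    simp only [fourier_one] at h
    exact AddCircle.injective_toCircle one_ne_zero (Circle.ext h)

theorem measurable_log_norm_eval (q : Polynomial ℂ) :
    Measurable fun x : T => Real.log ‖q.eval (fourier 1 x)‖ :=
  Real.measurable_log.comp (q.continuous.comp (fourier 1).continuous).norm.measurable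

theorem integrable_log_norm_eval (q : Polynomial ℂ) :
    Integrable (fun x : T => Real.log ‖q.eval (fourier 1 x)‖) mT := by
  have hpi : (2 * Real.pi) ≠ 0 := by positivity
  have h1 := (q.intervalIntegrable_mahlerMeasure).comp_mul_left (c := 2 * Real.pi)
  rw [zero_div, div_self hpi, intervalIntegrable_iff_integrableOn_Ioc_of_le zero_le_one] at h1
  rw [← volume_eq_mT]
  have h2 := UnitAddCircle.measurePreserving_mk 0
  rw [← h2.integrable_comp (measurable_log_norm_eval q).aestronglyMeasurable, zero_add]
  refine h1.congr (Filter.Eventually.of_forall fun x => ?_)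
  simp only [Function.comp, fourier_one_coe]

theorem integral_log_norm_eval (q : Polynomial ℂ) :
    ∫ x, Real.log ‖q.eval (fourier 1 x)‖ ∂mT = q.logMahlerMeasure := by
  rw [← volume_eq_mT, ← UnitAddCircle.intervalIntegral_preimage 0, zero_add,
    Polynomial.logMahlerMeasure_def, Real.circleAverage_def]
  simp only [fourier_one_coe]
  rw [intervalIntegral.integral_comp_mul_left
    (fun x => Real.log ‖q.eval (circleMap 0 1 x)‖) (by positivity : (2 * Real.pi) ≠ 0)]
  simp

/-- The Mahler measure dominates the modulus of the constant coefficient, the binomial factor being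
`1` at index `0`. -/
theorem logMahlerMeasure_nonneg_of_coeff_zero {q : Polynomial ℂ} (hq : q.coeff 0 = 1) :
    0 ≤ q.logMahlerMeasure := by
  rw [Polynomial.logMahlerMeasure_eq_log_MahlerMeasure]
  apply Real.log_nonneg
  simpa [hq] using q.norm_coeff_le_choose_mul_mahlerMeasure 0

/-- The lower bound in the theorem of Szegő. -/
theorem exp_integral_log_le {w : T → ℝ}
    (hpos : ∀ᵐ x ∂mT, 0 < w x) (hlog : Integrable (fun x => Real.log (w x)) mT)
    {q : Polynomial ℂ} (hq : q.coeff 0 = 1)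
    (hint : Integrable (fun x => (w x * ‖q.eval (fourier 1 x)‖) ^ 2) mT) :
    Real.exp (2 * ∫ x, Real.log (w x) ∂mT) ≤
      ∫ x, (w x * ‖q.eval (fourier 1 x)‖) ^ 2 ∂mT := by
  have hq0 : q ≠ 0 := fun h => by simp [h] at hq
  have hF := integrable_log_norm_eval q
  set g : T → ℝ := fun x => 2 * (Real.log (w x) + Real.log ‖q.eval (fourier 1 x)‖) with hg
  have hgi : Integrable g mT := (hlog.add hF).const_mul 2
  have he : (fun x => Real.exp (g x)) =ᵐ[mT] fun x => (w x * ‖q.eval (fourier 1 x)‖) ^ 2 := by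
    filter_upwards [hpos, ae_eval_fourier_ne_zero hq0] with x h1 h2
    have h3 : 0 < ‖q.eval (fourier 1 x)‖ := norm_pos_iff.2 h2
    rw [hg]
    simp only
    rw [← Real.log_mul h1.ne' h3.ne', two_mul, Real.exp_add, Real.exp_log (mul_pos h1 h3), pow_two]
  rw [← integral_congr_ae he]
  -- Jensen's inequality for `exp` and the probability measure `mT`; the contribution of `log |q|`
  -- to the exponent is the nonnegative logarithmic Mahler measure.
  refine le_trans ?_ (convexOn_exp.map_integral_le Real.continuous_exp.continuousOn isClosed_univ
    (by simp) hgi (hint.congr he.symm))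
  rw [Real.exp_le_exp, hg, integral_const_mul, integral_add hlog hF, integral_log_norm_eval]
  linarith [logMahlerMeasure_nonneg_of_coeff_zero hq]

/-! ### Functions with a single nonzero Fourier coefficient -/

/-- Integration against `g` is continuous on `C(T)`, and trigonometric polynomials are dense there.
-/
theorem integral_mul_eq_zero_of_fourier {g : T → ℂ} (hg : Integrable g mT)
    (h : ∀ k : ℤ, ∫ x, fourier k x * g x ∂mT = 0) (f : C(T, ℂ)) :
    ∫ x, f x * g x ∂mT = 0 := by
  have hi (f : C(T, ℂ)) : Integrable (fun x => f x * g x) mT :=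
    hg.bdd_mul f.continuous.aestronglyMeasurable
      (Filter.Eventually.of_forall fun x => f.norm_coe_le_norm x)
  let L : C(T, ℂ) →L[ℂ] ℂ := LinearMap.mkContinuous
    { toFun := fun f => ∫ x, f x * g x ∂mT
      map_add' := fun f₁ f₂ => by
        rw [← integral_add (hi f₁) (hi f₂)]
        simp only [ContinuousMap.add_apply, add_mul]
      map_smul' := fun c f => by
        rw [RingHom.id_apply, ← integral_smul]
        simp only [ContinuousMap.smul_apply, smul_mul_assoc] } (∫ x, ‖g x‖ ∂mT) fun f => by
    refine (norm_integral_le_integral_norm _).trans ?_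
    rw [mul_comm, ← integral_const_mul]
    refine integral_mono (hi f).norm (hg.norm.const_mul _) fun x => ?_
    rw [norm_mul]
    exact mul_le_mul_of_nonneg_right (f.norm_coe_le_norm x) (norm_nonneg _)
  have hle : (Submodule.span ℂ (Set.range (@fourier 1))).topologicalClosure ≤
      LinearMap.ker L.toLinearMap := by
    refine Submodule.topologicalClosure_minimal _ (Submodule.span_le.2 ?_) L.isClosed_ker
    rintro _ ⟨k, rfl⟩
    exact h k
  rw [span_fourier_closure_eq_top] at hle
  exact hle (Submodule.mem_top (x := f))

/-- The measures with densities `w` and `∫ w` agree on continuous functions, hence coincide, and so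
do their densities almost everywhere. -/
theorem ae_eq_const_of_fourier {w : T → ℝ} (hw : Integrable w mT) (h0 : ∀ x, 0 ≤ w x)
    (h : ∀ k : ℤ, k ≠ 0 → ∫ x, fourier k x * (w x : ℂ) ∂mT = 0) :
    ∀ᵐ x ∂mT, w x = ∫ y, w y ∂mT := by
  set c : ℝ := ∫ y, w y ∂mT with hc
  have hc0 : 0 ≤ c := integral_nonneg h0
  have hi : Integrable (fun x => ((w x : ℂ) - c)) mT := hw.ofReal.sub (integrable_const _)
  have hf (k : ℤ) : ∫ x, fourier k x * ((w x : ℂ) - c) ∂mT = 0 := by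
    have i1 : Integrable (fun x => fourier k x * (w x : ℂ)) mT :=
      hw.ofReal.bdd_mul (fourier k).continuous.aestronglyMeasurable
        (Filter.Eventually.of_forall fun x => (norm_fourier_apply k x).le)
    have i2 : Integrable (fun x => fourier k x * (c : ℂ)) mT :=
      (integrable_const (c : ℂ)).bdd_mul (fourier k).continuous.aestronglyMeasurable
        (Filter.Eventually.of_forall fun x => (norm_fourier_apply k x).le)
    simp only [mul_sub]
    rw [integral_sub i1 i2]
    rcases eq_or_ne k 0 with rfl | hk
    · simp only [fourier_zero, one_mul]
      rw [integral_complex_ofReal, ← hc]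
      simp
    · rw [h k hk, integral_mul_const]
      have := fourierCoeff_fourier (T := 1) k
      have h2 := congrFun this 0
      unfold fourierCoeff at h2
      simp only [neg_zero, fourier_zero, one_smul, Pi.single_apply, if_neg hk.symm] at h2
      rw [h2]; simp
  have key := integral_mul_eq_zero_of_fourier hi hf
  have hm1 : IsFiniteMeasure (mT.withDensity fun x => ENNReal.ofReal (w x)) :=
    isFiniteMeasure_withDensity_ofReal hw.2
  have hm2 : IsFiniteMeasure (mT.withDensity fun _ => ENNReal.ofReal c) :=
    isFiniteMeasure_withDensity_ofReal (integrable_const c).2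
  have hmeas : (mT.withDensity fun x => ENNReal.ofReal (w x)) =
      mT.withDensity fun _ => ENNReal.ofReal c := by
    refine ext_of_forall_integral_eq_of_IsFiniteMeasure fun f => ?_
    rw [integral_withDensity_eq_integral_toReal_smul₀ (by
        exact hw.1.aemeasurable.ennreal_ofReal) (by simp),
      integral_withDensity_eq_integral_toReal_smul₀ (by fun_prop) (by simp)]
    simp only [ENNReal.toReal_ofReal (h0 _), ENNReal.toReal_ofReal hc0, smul_eq_mul]
    have h1 := key ⟨fun x => (f x : ℂ), by fun_prop⟩
    simp only [ContinuousMap.coe_mk, ← Complex.ofReal_sub, ← Complex.ofReal_mul] at h1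
    rw [integral_complex_ofReal, Complex.ofReal_eq_zero] at h1
    have i1 : Integrable (fun x => f x * w x) mT :=
      hw.bdd_mul f.continuous.aestronglyMeasurable
        (Filter.Eventually.of_forall fun x => f.norm_coe_le_norm x)
    have i2 : Integrable (fun x => f x * c) mT :=
      (integrable_const c).bdd_mul f.continuous.aestronglyMeasurable
        (Filter.Eventually.of_forall fun x => f.norm_coe_le_norm x)
    simp only [mul_sub] at h1
    rw [integral_sub i1 i2, sub_eq_zero] at h1
    simp only [mul_comm _ (f _)]
    exact h1
  have := (withDensity_eq_iff_of_sigmaFinite hw.1.aemeasurable.ennreal_ofReal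
    aemeasurable_const).1 hmeas
  filter_upwards [this] with x hx
  exact (ENNReal.ofReal_eq_ofReal_iff (h0 x) hc0).1 hx

/-! ### Multiplication by bounded functions on `L²` -/

theorem boundedMul_memLp {b : T → ℂ} (hb : AEStronglyMeasurable b mT)
    (hb1 : ∀ᵐ x ∂mT, ‖b x‖ ≤ 1) (f : Lp ℂ 2 mT) : MemLp (fun x => b x * f x) 2 mT := by
  refine (Lp.memLp f).mono (hb.mul (Lp.memLp f).1) ?_
  filter_upwards [hb1] with x hx
  rw [norm_mul]
  exact mul_le_of_le_one_left (norm_nonneg _) hx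

/-- Multiplication by a function of modulus at most one. -/
def boundedMul (b : T → ℂ) (hb : AEStronglyMeasurable b mT) (hb1 : ∀ᵐ x ∂mT, ‖b x‖ ≤ 1) :
    Lp ℂ 2 mT →L[ℂ] Lp ℂ 2 mT :=
  LinearMap.mkContinuous
    { toFun := fun f => (boundedMul_memLp hb hb1 f).toLp
      map_add' := fun f g => by
        rw [← MemLp.toLp_add]
        refine MemLp.toLp_congr _ _ ?_
        filter_upwards [Lp.coeFn_add f g] with x hx
        simp only [hx, Pi.add_apply, mul_add]
      map_smul' := fun c f => by
        rw [RingHom.id_apply, ← MemLp.toLp_const_smul]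
        refine MemLp.toLp_congr _ _ ?_
        filter_upwards [Lp.coeFn_smul c f] with x hx
        simp only [hx, Pi.smul_apply, smul_eq_mul]
        ring } 1 fun f => by
    rw [one_mul]
    refine Lp.norm_le_norm_of_ae_le ?_
    filter_upwards [(boundedMul_memLp hb hb1 f).coeFn_toLp, hb1] with x hx h1
    change ‖(boundedMul_memLp hb hb1 f).toLp _ x‖ ≤ _
    rw [hx, norm_mul]
    exact mul_le_of_le_one_left (norm_nonneg _) h1

theorem boundedMul_ae {b : T → ℂ} (hb : AEStronglyMeasurable b mT)
    (hb1 : ∀ᵐ x ∂mT, ‖b x‖ ≤ 1) (f : Lp ℂ 2 mT) :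
    ∀ᵐ x ∂mT, boundedMul b hb hb1 f x = b x * f x :=
  (boundedMul_memLp hb hb1 f).coeFn_toLp

/-- Multiplication by `t ^ k`. -/
def fourierMul (k : ℤ) : Lp ℂ 2 mT →L[ℂ] Lp ℂ 2 mT :=
  boundedMul (fourier k) (fourier k).continuous.aestronglyMeasurable
    (Filter.Eventually.of_forall fun x => (norm_fourier_apply k x).le)

theorem fourierMul_ae (k : ℤ) (f : Lp ℂ 2 mT) :
    ∀ᵐ x ∂mT, fourierMul k f x = fourier k x * f x :=
  boundedMul_ae _ _ f

theorem inner_fourierLp (k : ℤ) (f : Lp ℂ 2 mT) :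
    inner ℂ (fourierLp 2 k) f = fourierCoeff f k := by
  rw [← fourierBasis_repr, HilbertBasis.repr_apply_apply, coe_fourierBasis]

theorem eq_zero_of_fourierCoeff {f : Lp ℂ 2 mT} (h : ∀ k, fourierCoeff f k = 0) : f = 0 := by
  refine (fourierBasis (T := 1)).repr.injective ?_
  rw [map_zero]
  refine lp.ext (funext fun k => ?_)
  rw [fourierBasis_repr, h k]
  rfl

theorem integral_norm_sq (f : Lp ℂ 2 mT) : ∫ x, ‖f x‖ ^ 2 ∂mT = ‖f‖ ^ 2 := by
  have h7 := L2.inner_def (𝕜 := ℂ) f f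
  rw [inner_self_eq_norm_sq_to_K] at h7
  have h8 : ∫ a, inner ℂ (f a) (f a) ∂mT = ((∫ y, ‖f y‖ ^ 2 ∂mT : ℝ) : ℂ) := by
    rw [← integral_complex_ofReal]
    congr 1
    ext x
    rw [inner_self_eq_norm_sq_to_K]
    push_cast
    rfl
  rw [h8] at h7
  apply Complex.ofReal_injective
  rw [← h7, Complex.ofReal_pow]
  rfl

/-- If `u` is orthogonal to `t ^ (-k) u` for all `k > 0`, then `|u|` is constant. -/
theorem ae_norm_eq_of_inner_fourierMul {u : Lp ℂ 2 mT}
    (h : ∀ k : ℤ, 0 < k → inner ℂ u (fourierMul (-k) u) = 0) : ∀ᵐ x ∂mT, ‖u x‖ = ‖u‖ := by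
  have hi : Integrable (fun x => ‖u x‖ ^ 2) mT :=
    (memLp_two_iff_integrable_sq_norm (Lp.memLp u).1).1 (Lp.memLp u)
  have h1 (k : ℤ) : inner ℂ u (fourierMul k u) =
      ∫ x, fourier k x * ((‖u x‖ ^ 2 : ℝ) : ℂ) ∂mT := by
    rw [L2.inner_def]
    refine integral_congr_ae ?_
    filter_upwards [fourierMul_ae k u] with x hx
    rw [RCLike.inner_apply, hx, mul_assoc, Complex.mul_conj']
    push_cast
    rfl
  have h2 (k : ℤ) (hk : k ≠ 0) : ∫ x, fourier k x * ((‖u x‖ ^ 2 : ℝ) : ℂ) ∂mT = 0 := by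
    rcases lt_or_gt_of_ne hk with hk | hk
    · rw [← h1, ← h (-k) (by omega), neg_neg]
    -- Positive frequencies follow from negative ones by conjugation, as `|u|²` is real.
    · have h3 := h k hk
      rw [h1] at h3
      have h4 := congrArg conj h3
      rw [← integral_conj, map_zero] at h4
      rw [← h4]
      congr 1
      ext x
      rw [map_mul, Complex.conj_ofReal, ← fourier_neg, neg_neg]
  have h5 := ae_eq_const_of_fourier hi (fun x => by positivity) h2
  filter_upwards [h5] with x hx
  rw [integral_norm_sq] at hx
  exact (sq_eq_sq₀ (norm_nonneg _) (norm_nonneg _)).1 hx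

end

section

variable (R : SzegoFunction)

/-! ### The weight `(1 - |R|²) ^ (1/2)` -/

/-- The function `(1 - |R|²) ^ (1/2)`. -/
def rho (x : T) : ℝ := Real.sqrt (1 - ‖R.toFun x‖ ^ 2)

theorem rho_pos : ∀ᵐ x ∂mT, 0 < rho R x := by
  filter_upwards [R.norm_lt_one] with x hx
  exact Real.sqrt_pos.2 (by nlinarith [norm_nonneg (R.toFun x)])

theorem rho_sq : ∀ᵐ x ∂mT, (rho R x : ℂ) ^ 2 = 1 - R.toFun x * conj (R.toFun x) := by
  filter_upwards [R.norm_lt_one] with x hx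
  rw [← Complex.ofReal_pow, rho, Real.sq_sqrt (by nlinarith [norm_nonneg (R.toFun x)]),
    Complex.mul_conj']
  push_cast
  rfl

theorem rho_le_one (x : T) : rho R x ≤ 1 :=
  Real.sqrt_le_one.2 (by nlinarith [norm_nonneg (R.toFun x)])

theorem norm_rho (x : T) : ‖(rho R x : ℂ)‖ = rho R x := by
  rw [Complex.norm_real, rho, Real.norm_of_nonneg (Real.sqrt_nonneg _)]

theorem aestronglyMeasurable_rho : AEStronglyMeasurable (fun x => (rho R x : ℂ)) mT := by
  have h : AEMeasurable R.toFun mT := R.aestronglyMeasurable.aemeasurable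
  apply AEMeasurable.aestronglyMeasurable
  unfold rho
  fun_prop

/-- Half the sum of `log (1 - |R|)`, integrable by assumption, and `log (1 + |R|)`, which lies
between `0` and `1`. -/
theorem integrable_log_rho : Integrable (fun x => Real.log (rho R x)) mT := by
  have h : AEMeasurable R.toFun mT := R.aestronglyMeasurable.aemeasurable
  have h1 : Integrable (fun x => Real.log (1 + ‖R.toFun x‖)) mT := by
    refine Integrable.mono' (integrable_const (1 : ℝ))
      (Real.measurable_log.comp_aemeasurable (by fun_prop)).aestronglyMeasurable ?_
    filter_upwards [R.norm_lt_one] with x hx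
    have h0 := norm_nonneg (R.toFun x)
    rw [Real.norm_of_nonneg (Real.log_nonneg (by linarith))]
    have := Real.log_le_sub_one_of_pos (show 0 < 1 + ‖R.toFun x‖ by linarith)
    linarith
  refine ((R.integrable_log.add h1).const_mul (1 / 2)).congr ?_
  filter_upwards [R.norm_lt_one] with x hx
  have h0 := norm_nonneg (R.toFun x)
  rw [rho, Real.log_sqrt (by nlinarith), show 1 - ‖R.toFun x‖ ^ 2 =
    (1 - ‖R.toFun x‖) * (1 + ‖R.toFun x‖) by ring, Real.log_mul (by linarith) (by linarith),
    Pi.add_apply]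
  ring

/-- Multiplication by `(1 - |R|²) ^ (1/2)` on `L²`. -/
def rhoMul : Lp ℂ 2 mT →L[ℂ] Lp ℂ 2 mT :=
  boundedMul (fun x => (rho R x : ℂ)) (aestronglyMeasurable_rho R)
    (Filter.Eventually.of_forall fun x => (norm_rho R x).trans_le (rho_le_one R x))

theorem rhoMul_ae (f : Lp ℂ 2 mT) : ∀ᵐ x ∂mT, rhoMul R f x = rho R x * f x :=
  boundedMul_ae _ _ f

theorem rhoMul_fourierLp_ae (k : ℤ) :
    ∀ᵐ x ∂mT, rhoMul R (fourierLp 2 k) x = rho R x * fourier k x := by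
  filter_upwards [rhoMul_ae R (fourierLp 2 k), coeFn_fourierLp (T := 1) 2 k] with x h1 h2
  rw [h1, h2]

/-- The closed span in `L²` of the functions `(1 - |R|²) ^ (1/2) t ^ k`, `k < -m`. -/
def weightedSpan (m : ℤ) : Submodule ℂ (Lp ℂ 2 mT) :=
  (Submodule.span ℂ ((fun k : ℤ => rhoMul R (fourierLp 2 k)) '' Set.Iio (-m))).topologicalClosure

instance (m : ℤ) : CompleteSpace (weightedSpan R m) :=
  inferInstanceAs (CompleteSpace (Submodule.topologicalClosure _))

variable {R}

theorem isClosed_weightedSpan (m : ℤ) : IsClosed (weightedSpan R m : Set (Lp ℂ 2 mT)) :=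
  Submodule.isClosed_topologicalClosure _

theorem rhoMul_fourierLp_mem {m k : ℤ} (hk : k < -m) :
    rhoMul R (fourierLp 2 k) ∈ weightedSpan R m :=
  Submodule.le_topologicalClosure _ (Submodule.subset_span ⟨k, hk, rfl⟩)

theorem weightedSpan_le {m : ℤ} {S : Submodule ℂ (Lp ℂ 2 mT)}
    (hS : IsClosed (S : Set (Lp ℂ 2 mT)))
    (h : ∀ k : ℤ, k < -m → rhoMul R (fourierLp 2 k) ∈ S) : weightedSpan R m ≤ S := by
  refine Submodule.topologicalClosure_minimal _ (Submodule.span_le.2 ?_) hS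
  rintro _ ⟨k, hk, rfl⟩
  exact h k hk

theorem apply_eq_zero_of_mem_weightedSpan {m : ℤ} (L : Lp ℂ 2 mT →L[ℂ] ℂ)
    (h : ∀ k : ℤ, k < -m → L (rhoMul R (fourierLp 2 k)) = 0) {f : Lp ℂ 2 mT}
    (hf : f ∈ weightedSpan R m) : L f = 0 :=
  weightedSpan_le (S := LinearMap.ker L.toLinearMap) L.isClosed_ker h hf

theorem rhoMul_mem {m : ℤ} {g : Lp ℂ 2 mT} (hg : g ∈ hardyMinus m) :
    rhoMul R g ∈ weightedSpan R m := by
  have h := (hasSum_fourier_series_L2 (T := 1) g).mapL (rhoMul R)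
  refine (isClosed_weightedSpan m).mem_of_tendsto h
    (Filter.Eventually.of_forall fun s => Submodule.sum_mem _ fun k _ => ?_)
  rw [map_smul]
  rcases lt_or_ge k (-m) with hk | hk
  · exact Submodule.smul_mem _ _ (rhoMul_fourierLp_mem hk)
  · rw [hg k hk, zero_smul]
    exact Submodule.zero_mem _

/-- Frequencies below `-m` become, after extracting `t ^ (-m)`, conjugates of polynomials without
constant term. Then `1 - p` has constant coefficient `1`, as the Szegő bound requires. -/
theorem exists_polynomial_of_mem_span {m : ℤ} {y : Lp ℂ 2 mT}
    (hy : y ∈ Submodule.span ℂ ((fun k : ℤ => rhoMul R (fourierLp 2 k)) '' Set.Iio (-m))) :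
    ∃ p : Polynomial ℂ, p.coeff 0 = 0 ∧
      ∀ᵐ x ∂mT, y x = rho R x * fourier (-m) x * conj (p.eval (fourier 1 x)) := by
  induction hy using Submodule.span_induction with
  | mem y hy =>
    obtain ⟨k, hk, rfl⟩ := hy
    obtain ⟨j, rfl⟩ : ∃ j : ℕ, k = -m - (j + 1 : ℕ) :=
      ⟨(-m - k - 1).toNat, by rw [Set.mem_Iio] at hk; omega⟩
    refine ⟨Polynomial.X ^ (j + 1), by simp, ?_⟩
    filter_upwards [rhoMul_fourierLp_ae R (-m - (j + 1 : ℕ))] with x hx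
    rw [hx, mul_assoc, sub_eq_add_neg, fourier_add]
    congr 2
    rw [Polynomial.eval_pow, Polynomial.eval_X, fourier_neg, fourier_apply, fourier_apply,
      natCast_zsmul, one_zsmul, AddCircle.toCircle_nsmul]
    push_cast
    rfl
  | zero =>
    refine ⟨0, by simp, ?_⟩
    filter_upwards [Lp.coeFn_zero ℂ 2 mT] with x hx
    rw [hx]
    simp
  | add y z _ _ hy hz =>
    obtain ⟨p, hp, h1⟩ := hy
    obtain ⟨q, hq, h2⟩ := hz
    refine ⟨p + q, by simp [hp, hq], ?_⟩
    filter_upwards [Lp.coeFn_add y z, h1, h2] with x h3 h4 h5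
    rw [h3, Pi.add_apply, h4, h5, Polynomial.eval_add, map_add, mul_add]
  | smul c y _ hy =>
    obtain ⟨p, hp, h1⟩ := hy
    refine ⟨Polynomial.C (conj c) * p, by simp [hp], ?_⟩
    filter_upwards [Lp.coeFn_smul c y, h1] with x h2 h3
    rw [h2, Pi.smul_apply, h3, Polynomial.eval_mul, Polynomial.eval_C, map_mul,
      Complex.conj_conj, smul_eq_mul]
    ring

/-- By the theorem of Szegő, `(1 - |R|²) ^ (1/2) t ^ (-m)` has positive distance to the span of
`(1 - |R|²) ^ (1/2) t ^ k`, `k < -m`. -/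
theorem rhoMul_fourierLp_notMem (m : ℤ) :
    rhoMul R (fourierLp 2 (-m)) ∉ weightedSpan R m := by
  intro hmem
  set v := rhoMul R (fourierLp 2 (-m))
  set D := Real.exp (2 * ∫ x, Real.log (rho R x) ∂mT)
  have hD : 0 < D := Real.exp_pos _
  -- The threshold is the Szegő bound: every `y` in the span satisfies `‖v - y‖² ≥ D`.
  obtain ⟨y, hy, hd⟩ := Metric.mem_closure_iff.1 hmem (Real.sqrt D) (Real.sqrt_pos.2 hD)
  obtain ⟨p, hp, hae⟩ := exists_polynomial_of_mem_span hy
  have h1 : (fun x => ‖(v - y) x‖ ^ 2) =ᵐ[mT]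
      fun x => (rho R x * ‖(1 - p).eval (fourier 1 x)‖) ^ 2 := by
    filter_upwards [Lp.coeFn_sub v y, rhoMul_fourierLp_ae R (-m), hae] with x h2 h3 h4
    rw [h2, Pi.sub_apply, h3, h4]
    congr 1
    have h5 : (rho R x : ℂ) * fourier (-m) x -
        rho R x * fourier (-m) x * conj (p.eval (fourier 1 x)) =
        rho R x * fourier (-m) x * conj ((1 - p).eval (fourier 1 x)) := by
      simp only [Polynomial.eval_sub, Polynomial.eval_one, map_sub, map_one]
      ring
    rw [h5, norm_mul, norm_mul, norm_rho, norm_fourier_apply, RCLike.norm_conj, mul_one]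
  have hi : Integrable (fun x => ‖(v - y) x‖ ^ 2) mT :=
    (memLp_two_iff_integrable_sq_norm (Lp.memLp (v - y)).1).1 (Lp.memLp (v - y))
  have h2 := exp_integral_log_le (rho_pos R) (integrable_log_rho R) (q := 1 - p)
    (by simp [hp]) (hi.congr h1)
  rw [← integral_congr_ae h1, integral_norm_sq] at h2
  rw [dist_eq_norm] at hd
  have h3 : ‖v - y‖ ^ 2 < D := by
    rw [← Real.sq_sqrt hD.le]
    exact pow_lt_pow_left₀ hd (norm_nonneg _) two_ne_zero
  exact absurd h2 (not_le.2 h3)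

theorem fourierMul_rhoMul_fourierLp (k j : ℤ) :
    fourierMul k (rhoMul R (fourierLp 2 j)) = rhoMul R (fourierLp 2 (k + j)) := by
  refine Lp.ext ?_
  filter_upwards [fourierMul_ae k (rhoMul R (fourierLp 2 j)), rhoMul_fourierLp_ae R j,
    rhoMul_fourierLp_ae R (k + j)] with x h1 h2 h3
  rw [h1, h2, h3, fourier_add]
  ring

/-- There is a unimodular function in the closed span of `(1 - |R|²) ^ (1/2) t ^ k`, `k ≤ 0`, which
is orthogonal to the closed span of `(1 - |R|²) ^ (1/2) t ^ k`, `k < 0`. -/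
theorem exists_unimodular : ∃ θ ∈ weightedSpan R (-1), (∀ᵐ x ∂mT, ‖θ x‖ = 1) ∧
    ∀ f ∈ weightedSpan R 0, inner ℂ θ f = 0 := by
  set v := rhoMul R (fourierLp 2 (-0)) with hv
  set u := v - (weightedSpan R 0).starProjection v with hu
  have hle : weightedSpan R 0 ≤ weightedSpan R (-1) :=
    weightedSpan_le (isClosed_weightedSpan _) fun k hk => rhoMul_fourierLp_mem (by omega)
  have hu1 : u ∈ weightedSpan R (-1) := Submodule.sub_mem _ (rhoMul_fourierLp_mem (by norm_num))
    (hle (Submodule.starProjection_apply_mem _ _))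
  have hu2 : ∀ f ∈ weightedSpan R 0, inner ℂ u f = 0 := fun f hf =>
    Submodule.starProjection_inner_eq_zero _ _ hf
  have hu0 : u ≠ 0 := fun h => rhoMul_fourierLp_notMem (R := R) 0 (by
    rw [← hv, sub_eq_zero.1 h]; exact Submodule.starProjection_apply_mem _ _)
  have hc : 0 < ‖u‖ := norm_pos_iff.2 hu0
  -- As `u` involves only frequencies at most `0`, multiplication by `t ^ (-k)` with `k > 0` moves
  -- it into the span of negative frequencies, to which `u` is orthogonal. So `|u|` is constant.
  have h1 := ae_norm_eq_of_inner_fourierMul (u := u) fun k hk =>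
    apply_eq_zero_of_mem_weightedSpan (R := R) (m := -1) ((innerSL ℂ u) ∘L fourierMul (-k))
      (fun j hj => by
        change inner ℂ u (fourierMul (-k) _) = 0
        rw [fourierMul_rhoMul_fourierLp]
        exact hu2 _ (rhoMul_fourierLp_mem (by omega))) hu1
  refine ⟨((‖u‖⁻¹ : ℝ) : ℂ) • u, Submodule.smul_mem _ _ hu1, ?_, fun f hf => ?_⟩
  · filter_upwards [h1, Lp.coeFn_smul ((‖u‖⁻¹ : ℝ) : ℂ) u] with x h2 h3
    rw [h3, Pi.smul_apply, norm_smul, h2, Complex.norm_real, norm_inv, norm_norm,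
      inv_mul_cancel₀ hc.ne']
  · rw [inner_smul_left, hu2 f hf, mul_zero]

/-! ### Weighted spans and Hardy spaces, compared by means of the unimodular function -/

section Unimodular

variable {θ : Lp ℂ 2 mT}

/-- Multiplication by a unimodular function. -/
def unimodularMul (hθ : ∀ᵐ x ∂mT, ‖θ x‖ = 1) : Lp ℂ 2 mT →L[ℂ] Lp ℂ 2 mT :=
  boundedMul θ (Lp.memLp θ).1 (hθ.mono fun _ h => h.le)

/-- Multiplication by the conjugate of a unimodular function. -/
def conjMul (hθ : ∀ᵐ x ∂mT, ‖θ x‖ = 1) : Lp ℂ 2 mT →L[ℂ] Lp ℂ 2 mT :=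
  boundedMul (fun x => conj (θ x)) (Complex.continuous_conj.comp_aestronglyMeasurable (Lp.memLp θ).1)
    (hθ.mono fun _ h => by rw [RCLike.norm_conj]; exact h.le)

theorem unimodularMul_ae (hθ : ∀ᵐ x ∂mT, ‖θ x‖ = 1) (f : Lp ℂ 2 mT) :
    ∀ᵐ x ∂mT, unimodularMul hθ f x = θ x * f x :=
  boundedMul_ae _ _ f

theorem conjMul_ae (hθ : ∀ᵐ x ∂mT, ‖θ x‖ = 1) (f : Lp ℂ 2 mT) :
    ∀ᵐ x ∂mT, conjMul hθ f x = conj (θ x) * f x :=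
  boundedMul_ae _ _ f

/-- On a generator the coefficient equals `⟨θ, ρ t ^ (k - i)⟩` with `k - i < 0`, which vanishes by
the choice of `θ`. Thus multiplication by `conj θ` maps `weightedSpan R m` into `hardyMinus m`. -/
theorem fourierCoeff_conjMul (hθ : ∀ᵐ x ∂mT, ‖θ x‖ = 1)
    (horth : ∀ f ∈ weightedSpan R 0, inner ℂ θ f = 0) {m i : ℤ} (hi : -m ≤ i) {f : Lp ℂ 2 mT}
    (hf : f ∈ weightedSpan R m) : fourierCoeff (conjMul hθ f) i = 0 := by
  rw [← inner_fourierLp]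
  refine apply_eq_zero_of_mem_weightedSpan
    ((innerSL ℂ (fourierLp (T := 1) 2 i)) ∘L conjMul hθ) (fun k hk => ?_) hf
  rw [← horth _ (rhoMul_fourierLp_mem (m := 0) (k := -i + k) (by omega)),
    ← fourierMul_rhoMul_fourierLp]
  change inner ℂ (fourierLp (T := 1) 2 i) (conjMul hθ _) = _
  rw [L2.inner_def, L2.inner_def]
  refine integral_congr_ae ?_
  filter_upwards [conjMul_ae hθ (rhoMul R (fourierLp 2 k)),
    fourierMul_ae (-i) (rhoMul R (fourierLp 2 k)), coeFn_fourierLp (T := 1) 2 i] with x h1 h2 h3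
  rw [RCLike.inner_apply, RCLike.inner_apply, h2, h1, h3, fourier_neg]
  ring

end Unimodular

/-- All Fourier coefficients of `conj θ f` vanish, and `θ` has no zeros up to a null set. -/
theorem eq_zero_of_forall_mem_weightedSpan {f : Lp ℂ 2 mT}
    (hf : ∀ m : ℕ, f ∈ weightedSpan R m) : f = 0 := by
  obtain ⟨θ, -, hθ, horth⟩ := exists_unimodular (R := R)
  have h1 : conjMul hθ f = 0 := eq_zero_of_fourierCoeff fun k =>
    fourierCoeff_conjMul hθ horth (m := ((-k).toNat : ℕ)) (by omega) (hf _)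
  refine Lp.ext ?_
  filter_upwards [conjMul_ae hθ f,
    hθ, Lp.coeFn_zero ℂ 2 mT] with x h2 h3 h4
  have h5 : conj (θ x) * f x = 0 := by
    rw [← h2, h1, h4, Pi.zero_apply]
  have h6 : conj (θ x) ≠ 0 := by
    rw [← norm_ne_zero_iff, RCLike.norm_conj, h3]; exact one_ne_zero
  rw [h4]
  exact (mul_eq_zero.1 h5).resolve_left h6

/-- This is the outer property of the weight, obtained by duality: `θ` is itself a limit of
combinations of `ρ t ^ k`, `k ≤ 0`. -/
theorem mem_hardyMinus_of_rhoMul_mem {m : ℤ} {f : Lp ℂ 2 mT}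
    (hf : rhoMul R f ∈ weightedSpan R m) : f ∈ hardyMinus m := by
  obtain ⟨θ, hmem, hθ, horth⟩ := exists_unimodular (R := R)
  intro i hi
  have hconj := conjMul_ae hθ (rhoMul R f)
  have hw := unimodularMul_ae hθ (reflectLp i f)
  have hr := (reflectLp_memLp i f).coeFn_toLp
  -- Against `ρ t ^ k`, the function `θ t ^ i conj f` gives the coefficient of `conj θ ρ f` at `i -
  -- k ≥ -m`, which is zero. Passing to the limit `θ`, and using `|θ| = 1`, one recovers the `i`-th
  -- coefficient of `f`.
  have key : inner ℂ (unimodularMul hθ (reflectLp i f)) θ = 0 := by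
    refine apply_eq_zero_of_mem_weightedSpan (R := R) (m := -1)
      (innerSL ℂ (unimodularMul hθ (reflectLp i f))) (fun k hk => ?_) hmem
    rw [← fourierCoeff_conjMul hθ horth (i := i - k) (by omega) hf, ← inner_fourierLp]
    change inner ℂ (unimodularMul hθ (reflectLp i f)) (rhoMul R (fourierLp 2 k)) = _
    rw [L2.inner_def, L2.inner_def]
    refine integral_congr_ae ?_
    filter_upwards [hconj, hw, hr, rhoMul_ae R f, rhoMul_fourierLp_ae R k,
      coeFn_fourierLp (T := 1) 2 (i - k)] with x h1 h2 h3 h4 h5 h6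
    rw [RCLike.inner_apply, RCLike.inner_apply, h5, h6]
    rw [h1, h2, reflectLp, h3, h4, map_mul, map_mul, Complex.conj_conj, ← fourier_neg, ← fourier_neg,
      show -(i - k) = -i + k by ring, fourier_add]
    ring
  rw [← inner_fourierLp, ← key, L2.inner_def, L2.inner_def]
  refine integral_congr_ae ?_
  filter_upwards [hw, hr, hθ, coeFn_fourierLp (T := 1) 2 i] with x h1 h2 h3 h4
  rw [RCLike.inner_apply, RCLike.inner_apply, h4, h1, reflectLp, h2]
  have h5 : θ x * conj (θ x) = 1 := by rw [Complex.mul_conj', h3]; norm_num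
  rw [map_mul, map_mul, Complex.conj_conj]
  linear_combination (-(f x * conj (fourier i x))) * h5

/-! ### The intersection of the spaces `H_{n,m}` over `m` -/

variable (R) in
/-- The map `f ↦ (1 - |R|²) ^ (-1/2) (f₂ - R f₁)` from `L^R` to `L²`. -/
def defect : LR R →L[ℂ] Lp ℂ 2 mT :=
  WithLp.sndL 2 ℂ _ _ ∘L (auxEquiv R).toLinearIsometry.toContinuousLinearMap

theorem defect_ae (f : LR R) :
    ∀ᵐ x ∂mT, defect R f x = (f.fn.2 x - R.toFun x * f.fn.1 x) / (rho R x : ℂ) :=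
  f.mem.2.coeFn_toLp

/-- The terms in `g₁` cancel, and `(1 - |R|²) g₂ / ρ = ρ g₂`. -/
theorem defect_weightMap (g : Lp ℂ 2 mT × Lp ℂ 2 mT) :
    defect R (weightMap R g) = rhoMul R g.2 := by
  refine Lp.ext ?_
  filter_upwards [defect_ae (weightMap R g), weightMap_ae (R := R) g, rhoMul_ae R g.2, rho_sq R,
    rho_pos R] with x h1 h2 h3 h4 h5
  have h6 : (rho R x : ℂ) ≠ 0 := by exact_mod_cast h5.ne'
  rw [h1, h2.1, h2.2, h3, div_eq_iff h6]
  linear_combination (-g.2 x) * h4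

theorem defect_mem {n m : ℤ} {f : LR R} (hf : f ∈ checkH R n m) :
    defect R f ∈ weightedSpan R m := by
  have hle : checkH R n m ≤ (weightedSpan R m).comap (defect R).toLinearMap := by
    refine Submodule.topologicalClosure_minimal _ ?_
      ((isClosed_weightedSpan m).preimage (defect R).continuous)
    rintro _ ⟨g, hg, rfl⟩
    change defect R (weightMap R g) ∈ weightedSpan R m
    rw [defect_weightMap]
    exact rhoMul_mem hg.2
  exact hle hf

/-- Otherwise the defect map would place `ρ t ^ (-(m + 1))` in the closed span of lower frequencies,
against Szegő. -/
theorem d_notMem (n m : ℤ) : d R m ∉ checkH R n (m + 1) := by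
  intro h
  have h1 := defect_mem h
  rw [d, defect_weightMap] at h1
  exact rhoMul_fourierLp_notMem _ h1

theorem e_notMem (n m : ℤ) : e R n ∉ checkH R (n + 1) m := by
  intro h
  have h1 : reflect R 0 (e R n) ∈ checkH R (m + 1) (n - 1 + 1) :=
    reflect_mem 0 (by ring) (by ring) h
  rw [reflect_e, sub_zero] at h1
  exact d_notMem _ _ h1

/-- Since `W⁻¹ e_n = (t ^ n, 0)`, pairing with `e_n` sees only the first component. -/
theorem inner_e (n : ℤ) (f : LR R) : inner ℂ (e R n) f = fourierCoeff f.fn.1 n := by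
  rw [inner_def]
  unfold fourierCoeff
  refine integral_congr_ae ?_
  filter_upwards [weightMap_ae (R := R) (fourierLp 2 n, 0), R.norm_lt_one,
    coeFn_fourierLp (T := 1) 2 n, Lp.coeFn_zero ℂ 2 mT] with x h1 h2 h3 h4
  rw [e, h1.1, h1.2, h3]
  have h0 : (0 : ℝ) < 1 - ‖R.toFun x‖ ^ 2 := by nlinarith [norm_nonneg (R.toFun x)]
  have h5 : ((1 - ‖R.toFun x‖ ^ 2 : ℝ) : ℂ) = 1 - R.toFun x * conj (R.toFun x) := by
    rw [Complex.mul_conj']; push_cast; ring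
  have h6 : (1 - R.toFun x * conj (R.toFun x) : ℂ) ≠ 0 := by rw [← h5]; exact_mod_cast h0.ne'
  rw [wForm, h5, div_eq_iff h6, fourier_neg, smul_eq_mul]
  simp only [h4, Pi.zero_apply, mul_zero, add_zero, map_mul]
  ring

/-- Elements of all `H_{n,m}`, `m ≥ 0`, are of the form `(f₁, R f₁)` with `f₁` in `t ^ n H²₊`. -/
theorem inner_e_eq_zero_of_forall_mem {n : ℤ} {f : LR R}
    (hf : ∀ m : ℕ, f ∈ checkH R (n + 1) m) : inner ℂ (e R n) f = 0 := by
  have h1 : defect R f = 0 := eq_zero_of_forall_mem_weightedSpan fun m => defect_mem (hf m)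
  set g : Lp ℂ 2 mT := f.mem.1.toLp with hg
  have hga : ∀ᵐ x ∂mT, g x = f.fn.1 x := f.mem.1.coeFn_toLp
  -- As `f = (f₁, R f₁)`, the defect of its reflection is `(1 - |R|²) conj f₁ / ρ = ρ conj f₁`.
  have h2 : defect R (reflect R 0 f) = rhoMul R (reflectLp 0 g) := by
    refine Lp.ext ?_
    filter_upwards [defect_ae f, defect_ae (reflect R 0 f), reflect_ae 0 f,
      rhoMul_ae R (reflectLp 0 g), (reflectLp_memLp 0 g).coeFn_toLp, hga, rho_sq R, rho_pos R,
      Lp.coeFn_zero ℂ 2 mT] with x h3 h4 h5 h6 h7 h8 h9 h10 h11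
    have h12 : (rho R x : ℂ) ≠ 0 := by exact_mod_cast h10.ne'
    rw [h1, h11, Pi.zero_apply, eq_comm, div_eq_zero_iff, or_iff_left h12, sub_eq_zero] at h3
    rw [h4, h6, h5.1, h5.2, h3, reflectLp, h7, h8, div_eq_iff h12, map_mul]
    linear_combination (-(fourier 0 x * conj (f.fn.1 x))) * h9
  -- The second index `n` makes the coefficients of `conj f₁` vanish from `-n` on; the boundary
  -- index `-n` is the `n`-th coefficient of `f₁`.
  have h3 : reflect R 0 f ∈ checkH R 1 n := reflect_mem 0 (by ring) (by ring) (hf 0)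
  have h4 := defect_mem h3
  rw [h2] at h4
  have h5 := mem_hardyMinus_of_rhoMul_mem h4 (-n) le_rfl
  rw [fourierCoeff_reflectLp, map_eq_zero, zero_sub, neg_neg] at h5
  rw [inner_e, ← h5]
  exact congrFun (fourierCoeff_congr_ae (hga.mono fun x hx => hx.symm)) n

end

section

variable {R : SzegoFunction}

/-! ### The limits of the normalized vectors -/

/-- The orthogonal complements increase with `m`, so the projections onto them converge strongly to
the projection onto the closure of their union. That closure contains `e_n`, because `e_n` is
orthogonal to the intersection of the spaces `H_{n+1,m}`. -/
theorem tendsto_starProjection_e (n : ℤ) :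
    Tendsto (fun m : ℤ => (checkH R (n + 1) m).starProjection (e R n)) atTop (nhds 0) := by
  set V : ℤ → Submodule ℂ (LR R) := fun m => (checkH R (n + 1) m)ᗮ
  have hmono : Monotone V := fun m m' h =>
    Submodule.orthogonal_le (checkH_le R le_rfl h)
  have h1 := Submodule.starProjection_tendsto_closure_iSup V hmono (e R n)
  have hmem : e R n ∈ (⨆ m, V m).topologicalClosure := by
    rw [← Submodule.orthogonal_orthogonal_eq_closure]
    intro f hf
    rw [inner_eq_zero_symm]
    refine inner_e_eq_zero_of_forall_mem fun m => ?_
    have h2 : f ∈ (V m)ᗮ := Submodule.orthogonal_le (le_iSup V (m : ℤ)) hf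
    rwa [Submodule.orthogonal_orthogonal] at h2
  rw [Submodule.starProjection_eq_self_iff.2 hmem] at h1
  have h2 := (tendsto_const_nhds (x := e R n)).sub h1
  rw [sub_self] at h2
  refine h2.congr fun m => ?_
  rw [Submodule.starProjection_orthogonal_val, sub_sub_cancel]

theorem norm_e (n : ℤ) : ‖e R n‖ = 1 := by
  have h : inner ℂ (e R n) (e R n) = 1 := by
    rw [inner_e]
    have h1 : fourierCoeff (e R n).fn.1 n = fourierCoeff (fourierLp (T := 1) 2 n) n := by
      refine congrFun (fourierCoeff_congr_ae ?_) n
      filter_upwards [weightMap_ae (R := R) (fourierLp 2 n, 0), Lp.coeFn_zero ℂ 2 mT] with x h2 h3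
      rw [e, h2.1, h3, Pi.zero_apply, mul_zero, add_zero]
    rw [h1, fourierCoeff_fourierLp, if_pos rfl]
  rw [@norm_eq_sqrt_re_inner ℂ, h]
  simp

theorem norm_d (m : ℤ) : ‖d R m‖ = 1 := by
  rw [← norm_e (R := R) (m + 1 + 0), ← reflect_d, LinearIsometry.norm_map]

/-! ### Normalized pairs: existence, uniqueness and behaviour under reflection -/

section Normalized

variable {n m : ℤ} {K : checkDelta R n m} {Kt : checkDeltaT R n m}

/-- The values at the origin are the inner products with `e_n` and `d_m`, so the conditions on `K`
and on `K~` decouple. -/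
theorem isNormalized_iff : IsNormalized K Kt ↔
    (‖(K : LR R)‖ = 1 ∧ ∃ r : ℝ, 0 < r ∧ inner ℂ (K : LR R) (e R n) = r) ∧
    (‖(Kt : LR R)‖ = 1 ∧ ∃ r : ℝ, 0 < r ∧ inner ℂ (Kt : LR R) (d R m) = r) := by
  have hsymm : (∃ r : ℝ, 0 < r ∧ inner ℂ (d R m) (Kt : LR R) = r) ↔
      ∃ r : ℝ, 0 < r ∧ inner ℂ (Kt : LR R) (d R m) = r := by
    refine exists_congr fun r => and_congr_right fun _ => ?_
    rw [← inner_conj_symm, ← Complex.conj_ofReal, (starRingEnd ℂ).injective.eq_iff, Complex.conj_ofReal]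
  constructor
  · rintro ⟨h1, h2, h3, h4⟩
    rw [checkA_zero h1 h2] at h3
    rw [checkA'_zero h1 h2, hsymm] at h4
    exact ⟨⟨h1, h3⟩, h2, h4⟩
  · rintro ⟨⟨h1, h3⟩, h2, h4⟩
    refine ⟨h1, h2, ?_, ?_⟩
    · rw [checkA_zero h1 h2]; exact h3
    · rw [checkA'_zero h1 h2, hsymm]; exact h4

theorem existsUnique_isNormalized (n m : ℤ) :
    ∃! p : checkDelta R n m × checkDeltaT R n m, IsNormalized p.1 p.2 := by
  obtain ⟨K, hK, h1, h2⟩ := exists_unit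
    (sub_starProjection_mem_checkDelta (e_mem R n m))
    (inner_sub_starProjection_ne_zero (e_notMem n m))
  obtain ⟨Kt, hKt, h3, h4⟩ := exists_unit
    (sub_starProjection_mem_checkDeltaT (d_mem R n m))
    (inner_sub_starProjection_ne_zero (d_notMem n m))
  refine ⟨(⟨K, hK⟩, ⟨Kt, hKt⟩), isNormalized_iff.2 ⟨⟨h1, h2⟩, h3, h4⟩, ?_⟩
  rintro ⟨K', Kt'⟩ h
  obtain ⟨⟨h1', h2'⟩, h3', h4'⟩ := isNormalized_iff.1 h
  refine Prod.ext (Subtype.ext ?_) (Subtype.ext ?_)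
  · exact unit_unique (fun x => eq_zero_of_inner_e) hK K'.2 h1 h1' h2 h2'
  · exact unit_unique (fun x => eq_zero_of_inner_d) hKt Kt'.2 h3 h3' h4 h4'

/-- The residual of `e_n` lies on the line `Δ_{n,m}`, hence equals `⟨e_n, K⟩ K`, and this scalar is
positive. -/
theorem IsNormalized.inner_e_eq (h : IsNormalized K Kt) : inner ℂ (K : LR R) (e R n) =
    ((‖e R n - (checkH R (n + 1) m).starProjection (e R n)‖ : ℝ) : ℂ) := by
  obtain ⟨⟨h1, r, hr, h2⟩, -⟩ := isNormalized_iff.1 h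
  have h3 := starProjection_add_inner_smul h1 (e_mem R n m)
  have h4 : e R n - (checkH R (n + 1) m).starProjection (e R n) =
      inner ℂ (K : LR R) (e R n) • (K : LR R) := by
    rw [sub_eq_iff_eq_add', h3]
  rw [h4, norm_smul, h1, mul_one, h2, Complex.norm_real, Real.norm_of_nonneg hr.le]

/-- The reflected vector is a unit vector of `Δ~` with the same positive pairing, now with `d`;
uniqueness identifies it. -/
theorem IsNormalized.reflect_eq (h : IsNormalized K Kt) {n' m' : ℤ} {K' : checkDelta R n' m'}
    {Kt' : checkDeltaT R n' m'} (h' : IsNormalized K' Kt') {s : ℤ} (hn : n' = m + 1 + s)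
    (hm : m' = n - 1 - s) : reflect R s (K : LR R) = Kt' := by
  obtain ⟨⟨h1, r, hr, h2⟩, -⟩ := isNormalized_iff.1 h
  obtain ⟨-, h3, h4⟩ := isNormalized_iff.1 h'
  refine unit_unique (fun x => eq_zero_of_inner_d) Kt'.2
    (reflect_mem_checkDeltaT s hn hm K.2) h3 ?_ h4 ⟨r, hr, ?_⟩
  · rw [LinearIsometry.norm_map, h1]
  · rw [hm, ← reflect_e, inner_reflect, ← inner_conj_symm, h2, Complex.conj_ofReal]

/-- Any two index pairs with the same sum are related by exactly one reflection, `s = n - 1 - m'`.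
-/
theorem IsNormalized.s1coeff_eq_s2coeff (h : IsNormalized K Kt) {n' m' : ℤ}
    {K' : checkDelta R n' m'} {Kt' : checkDeltaT R n' m'} (h' : IsNormalized K' Kt')
    (hsum : n + m = n' + m') (k : ℤ) : s1coeff K Kt (k - n) = s2coeff K' Kt' (k - m') := by
  obtain ⟨s, hm⟩ : ∃ s, m' = n - 1 - s := ⟨n - 1 - m', by ring⟩
  have hn : n' = m + 1 + s := by omega
  rcases lt_or_ge k 0 with hk | hk
  · rw [s1coeff_sub_of_neg h.norm_K h.norm_Kt hk, s2coeff_sub_of_neg h'.norm_K h'.norm_Kt hk]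
  · lift k to ℕ using hk
    rw [s1coeff_sub_natCast h.norm_K h.norm_Kt, s2coeff_sub_natCast h'.norm_K h'.norm_Kt,
      ← h.reflect_eq h' hn hm, inner_compression_pow_reflect s hn hm, ← inner_reflect s,
      reflect_e, hm]

theorem IsNormalized.checkA_eq_checkA' (h : IsNormalized K Kt) {n' m' : ℤ}
    {K' : checkDelta R n' m'} {Kt' : checkDeltaT R n' m'} (h' : IsNormalized K' Kt')
    (hsum : n + m = n' + m') : checkA K Kt = checkA' K' Kt' := by
  unfold checkA checkA'
  congr 1
  funext k
  exact h.s1coeff_eq_s2coeff h' hsum k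

end Normalized

/-- For unit vectors `‖q - v‖² = 2 - 2 Re ⟨q, v⟩`. -/
theorem tendsto_of_tendsto_inner {ι E : Type*} [NormedAddCommGroup E] [InnerProductSpace ℂ E]
    {l : Filter ι} {v : E} {q : ι → E} (hv : ‖v‖ = 1) (hq : ∀ i, ‖q i‖ = 1)
    (h : Tendsto (fun i => inner ℂ (q i) v) l (nhds 1)) : Tendsto q l (nhds v) := by
  have h1 : Tendsto (fun i => ‖q i - v‖ ^ 2) l (nhds 0) := by
    have h2 : Tendsto (fun i => 2 - 2 * (inner ℂ (q i) v).re) l (nhds (2 - 2 * (1 : ℂ).re)) :=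
      tendsto_const_nhds.sub (((Complex.continuous_re.tendsto 1).comp h).const_mul 2)
    rw [Complex.one_re, mul_one, sub_self] at h2
    refine h2.congr fun i => ?_
    rw [@norm_sub_sq ℂ, hq, hv]
    simp only [RCLike.re_to_complex]
    ring
  have h3 := h1.sqrt
  rw [Real.sqrt_zero] at h3
  rw [tendsto_iff_norm_sub_tendsto_zero]
  exact h3.congr fun i => Real.sqrt_sq (norm_nonneg _)

theorem tendsto_inner_e {n : ℤ} (K : (m : ℤ) → checkDelta R n m)
    (Kt : (m : ℤ) → checkDeltaT R n m) (h : ∀ m, IsNormalized (K m) (Kt m)) :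
    Tendsto (fun m => inner ℂ (K m : LR R) (e R n)) atTop (nhds 1) := by
  have h1 := ((tendsto_const_nhds (x := e R n)).sub (tendsto_starProjection_e n)).norm
  rw [sub_zero, norm_e] at h1
  have h2 := (Complex.continuous_ofReal.tendsto 1).comp h1
  rw [Complex.ofReal_one] at h2
  exact h2.congr fun m => ((h m).inner_e_eq).symm

end

end CMV

end

/-! ### The theorem -/

theorem theoremT (R : CMV.SzegoFunction) :
    (∀ n m : ℤ, ∃! p : CMV.checkDelta R n m × CMV.checkDeltaT R n m,
      CMV.IsNormalized p.1 p.2) ∧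
    ∀ (K : (n m : ℤ) → CMV.checkDelta R n m) (Kt : (n m : ℤ) → CMV.checkDeltaT R n m),
      (∀ n m : ℤ, CMV.IsNormalized (K n m) (Kt n m)) →
      (∀ n : ℤ, Filter.Tendsto (fun m : ℤ => (K n m : CMV.LR R)) Filter.atTop
        (nhds (CMV.e R n))) ∧
      (∀ m : ℤ, Filter.Tendsto (fun n : ℤ => (Kt n m : CMV.LR R)) Filter.atTop
        (nhds (CMV.d R m))) ∧
      ∃ a : ℤ → ℂ → ℂ,
        (∀ (n m : ℤ) (z : ℂ), ‖z‖ < 1 →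
          CMV.checkA (K n m) (Kt n m) z = a (n + m) z ∧
          CMV.checkA' (K n m) (Kt n m) z = a (n + m) z) ∧
        Filter.Tendsto (fun j : ℤ => a j 0) Filter.atTop (nhds 1) := by
  refine ⟨CMV.existsUnique_isNormalized, fun K Kt h => ?_⟩
  have hA (n m : ℤ) : CMV.checkA (K n m) (Kt n m) = CMV.checkA' (K 0 (n + m)) (Kt 0 (n + m)) :=
    (h n m).checkA_eq_checkA' (h 0 (n + m)) (by ring)
  -- Two functions `t ^ m s₂` on one antidiagonal are compared through `t ^ n s₁` at `(0, n + m)`.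
  have hA' (n m : ℤ) : CMV.checkA' (K n m) (Kt n m) = CMV.checkA' (K 0 (n + m)) (Kt 0 (n + m)) :=
    ((h 0 (n + m)).checkA_eq_checkA' (h n m) (by ring)).symm.trans
      ((h 0 (n + m)).checkA_eq_checkA' (h 0 (n + m)) rfl)
  have ha : Filter.Tendsto (fun j : ℤ => CMV.checkA' (K 0 j) (Kt 0 j) 0) Filter.atTop (nhds 1) := by
    refine (CMV.tendsto_inner_e (K 0) (Kt 0) (h 0)).congr fun m => ?_
    rw [← CMV.checkA_zero (h 0 m).norm_K (h 0 m).norm_Kt, hA, zero_add]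
  -- The pair `(0, j)` serves as representative of the antidiagonal with sum `j`.
  refine ⟨fun n => ?_, fun m => ?_, fun j => CMV.checkA' (K 0 j) (Kt 0 j),
    fun n m z _ => ⟨congrFun (hA n m) z, congrFun (hA' n m) z⟩, ha⟩
  · exact CMV.tendsto_of_tendsto_inner (CMV.norm_e n) (fun m => (h n m).norm_K)
      (CMV.tendsto_inner_e (K n) (Kt n) (h n))
  · refine CMV.tendsto_of_tendsto_inner (CMV.norm_d m) (fun n => (h n m).norm_Kt) ?_
    -- The limit of `K~` needs no further analysis: `⟨K~, d_m⟩` is the value at the origin of the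
    -- function with index `n + m`, and `n + m → ∞`.
    have h1 := ha.comp (Filter.tendsto_atTop_add_const_right Filter.atTop m Filter.tendsto_id)
    have h2 := (Complex.continuous_conj.tendsto 1).comp h1
    rw [map_one] at h2
    refine h2.congr fun n => ?_
    have h3 := congrFun (hA' n m) 0
    rw [CMV.checkA'_zero (h n m).norm_K (h n m).norm_Kt] at h3
    simp only [Function.comp, id]
    rw [← h3, inner_conj_symm]
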